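/- Consider a 3-user discrete memoryless interference channel with finite input alphabets $\mathcal X_1,\mathcal X_2,\mathcal X_3$, finite output alphabets $\mathcal Y_1,\mathcal Y_2,\mathcal Y_3$ and transition probability $p(y_1,y_2,y_3\mid x_1,x_2,x_3)$. User $i$ encodes an independent message $W_i$, uniform on a set of $\lceil 2^{nR_i}\rceil$ elements ($R_i\ge 0$), into a codeword $X_i^n$, and receiver $i$ forms an estimate $W_i'$ of $W_i$ from $Y_i^n$ alone. The triple $(R_1,R_2,R_3)$ is achievable if there is a sequence of such codes, $n\to\infty$, with $P\{(W_1',W_2',W_3')\ne(W_1,W_2,W_3)\}\to 0$, and the capacity region is the closure of the set of achievable triples. Mutual informations are in bits. Suppose that, for all product input distributions $p_{X_1}(x_1)p_{X_2}(x_2)p_{X_3}(x_3)$, \begin{align*} &I[X_3;Y_2]\ge I[X_3;Y_3|X_1,X_2],\quad I[X_2;Y_3]\ge I[X_2;Y_2|X_3,X_1],\quad I[X_3;Y_1]\ge I[X_3;Y_3|X_1,X_2],\\ &I[X_1;Y_1|X_2,X_3]\le I[X_1;Y_3|X_2,X_3],\quad I[X_2;Y_2|X_3,X_1]\le I[X_2;Y_1|X_3,X_1],\quad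 I[X_1;Y_1|X_2,X_3]\le I[X_1;Y_2|X_2,X_3]. \end{align*} Then the capacity region is the set of all triples $(R_1,R_2,R_3)$ of nonnegative reals such that \begin{align*} R_1&\le I[X_1;Y_1|X_2,X_3,Q],\qquad R_2\le I[X_2;Y_2|X_3,X_1,Q],\qquad R_3\le I[X_3;Y_3|X_1,X_2,Q],\\ R_1+R_2&\le \min\{I[X_1,X_2;Y_1|X_3,Q],\ I[X_1,X_2;Y_2|X_3,Q]\},\\ R_3+R_1&\le I[X_3,X_1;Y_3|X_2,Q] \end{align*} for some joint distribution $p_Q(q)p_{X_1|Q}(x_1|q)p_{X_2|Q}(x_2|q)p_{X_3|Q}(x_3|q)$ of a time-sharing variable $Q$ and the inputs, where $Q$ takes at most $7$ values. Equivalently, the capacity region consists of the nonnegative triples in the closure of the set of all $(R_1,R_2,R_3)\in\mathbb R^3$ that satisfy these five bounds with $<$ in place of $\le$ for some such joint distribution. -/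

import Mathlib

open Filter Topology

/-! Entropy and mutual information (in bits) of finite-valued random variables.
A probability mass function on a finite sample space `Ω` is a function `p : Ω → ℝ` and random
variables are functions on `Ω`. -/

section Information

variable {Ω α β γ : Type*} [Fintype Ω] [Fintype α] [Fintype β] [Fintype γ]

open Classical in
/-- The law of the random variable `A` under `p`, i.e. `a ↦ P(A = a)`. -/
noncomputable def lawOf (p : Ω → ℝ) (A : Ω → α) (a : α) : ℝ :=
  ∑ ω, if A ω = a then p ω else 0

/-- The entropy `H[A]` in bits; `Real.negMulLog t = -t * log t`, with value `0` at `t = 0`. -/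
noncomputable def entropy (p : Ω → ℝ) (A : Ω → α) : ℝ :=
  (∑ a, Real.negMulLog (lawOf p A a)) / Real.log 2

/-- The mutual information `I[A; B]` in bits. -/
noncomputable def mutualInfo (p : Ω → ℝ) (A : Ω → α) (B : Ω → β) : ℝ :=
  entropy p A + entropy p B - entropy p (fun ω => (A ω, B ω))

/-- The conditional mutual information `I[A; B | C] = H[A | C] + H[B | C] - H[A, B | C]`
in bits, where `H[A | C] = H[A, C] - H[C]`. -/
noncomputable def condMutualInfo (p : Ω → ℝ) (A : Ω → α) (B : Ω → β) (C : Ω → γ) : ℝ :=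
  entropy p (fun ω => (A ω, C ω)) + entropy p (fun ω => (B ω, C ω))
    - entropy p (fun ω => (A ω, B ω, C ω)) - entropy p C

end Information

/-- A 3-user discrete memoryless interference channel with finite input alphabets `X i` and
finite output alphabets `Y i`: the one-letter transition probability
`p(y₁, y₂, y₃ | x₁, x₂, x₃)`. The users and receivers `1, 2, 3` carry the indices `0, 1, 2`. -/
structure DMIC (X Y : Fin 3 → Type*) [∀ i, Fintype (X i)] [∀ i, Fintype (Y i)] where
  prob : (∀ i, X i) → (∀ i, Y i) → ℝ
  prob_mem : ∀ x, prob x ∈ stdSimplex ℝ (∀ i, Y i)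

/-- A code of block length `n` in which user `i` has `M i` messages: an encoder per user, which
sees only the message of that user, and a decoder per receiver, which sees only the output
sequence of that receiver. -/
structure InterferenceCode (X Y : Fin 3 → Type*) (M : Fin 3 → ℕ) (n : ℕ) where
  enc : ∀ i, Fin (M i) → Fin n → X i
  dec : ∀ i, (Fin n → Y i) → Fin (M i)

namespace DMIC

variable {X Y : Fin 3 → Type*} [∀ i, Fintype (X i)] [∀ i, Fintype (Y i)]

/-- The average probability of error `P{(W₁', W₂', W₃') ≠ (W₁, W₂, W₃)}` for independent,
uniformly distributed messages and `n` uses of the memoryless channel. -/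
noncomputable def errorProb (W : DMIC X Y) {M : Fin 3 → ℕ} {n : ℕ}
    (C : InterferenceCode X Y M n) : ℝ :=
  (∏ i, (M i : ℝ))⁻¹ * ∑ w : ∀ i, Fin (M i), ∑ y : Fin n → ∀ i, Y i,
    if (fun i => C.dec i (fun t => y t i)) ≠ w then
      ∏ t, W.prob (fun i => C.enc i (w i) t) (y t)
    else 0

/-- The nonnegative rate triple `R` is achievable: there are codes with `⌈2 ^ (n R i)⌉` messages
for user `i` and block length `n = 0, 1, 2, …` whose error probability tends to `0`. -/
def Achievable (W : DMIC X Y) (R : Fin 3 → ℝ) : Prop :=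
  (∀ i, 0 ≤ R i) ∧
    ∃ C : ∀ n : ℕ, InterferenceCode X Y (fun i => ⌈(2 : ℝ) ^ ((n : ℝ) * R i)⌉₊) n,
      Tendsto (fun n => W.errorProb (C n)) atTop (𝓝 0)

/-- The capacity region: the closure of the set of achievable rate triples. -/
def capacityRegion (W : DMIC X Y) : Set (Fin 3 → ℝ) :=
  closure {R | W.Achievable R}

/-- The joint law of inputs and outputs when the inputs are independent with laws `p i`. -/
noncomputable def jointLaw (W : DMIC X Y) (p : ∀ i, stdSimplex ℝ (X i)) :
    (∀ i, X i) × (∀ i, Y i) → ℝ :=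
  fun ω => (∏ i, (p i : X i → ℝ) (ω.1 i)) * W.prob ω.1 ω.2

/-- The joint law of `(Q, (X₁, X₂, X₃), (Y₁, Y₂, Y₃))` when `Q` has law `pQ` and, given `Q = q`,
the inputs are independent with laws `pX q i`. -/
noncomputable def timeSharingLaw (W : DMIC X Y) {𝒬 : Type*} [Fintype 𝒬]
    (pQ : stdSimplex ℝ 𝒬) (pX : 𝒬 → ∀ i, stdSimplex ℝ (X i)) :
    𝒬 × (∀ i, X i) × (∀ i, Y i) → ℝ :=
  fun ω => (pQ : 𝒬 → ℝ) ω.1 * W.jointLaw (pX ω.1) ω.2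

/-- All real triples that satisfy the strict rate bounds for some time-sharing variable `Q` with
at most seven values (some of the seven points may have probability `0`). -/
def strictRegion (W : DMIC X Y) : Set (Fin 3 → ℝ) :=
  {R | ∃ (pQ : stdSimplex ℝ (Fin 7)) (pX : Fin 7 → ∀ i, stdSimplex ℝ (X i)),
    R 0 < condMutualInfo (W.timeSharingLaw pQ pX)
      (fun ω => ω.2.1 0) (fun ω => ω.2.2 0) (fun ω => (ω.2.1 1, ω.2.1 2, ω.1)) ∧
    R 1 < condMutualInfo (W.timeSharingLaw pQ pX)
      (fun ω => ω.2.1 1) (fun ω => ω.2.2 1) (fun ω => (ω.2.1 2, ω.2.1 0, ω.1)) ∧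
    R 2 < condMutualInfo (W.timeSharingLaw pQ pX)
      (fun ω => ω.2.1 2) (fun ω => ω.2.2 2) (fun ω => (ω.2.1 0, ω.2.1 1, ω.1)) ∧
    R 0 + R 1 < min
      (condMutualInfo (W.timeSharingLaw pQ pX)
        (fun ω => (ω.2.1 0, ω.2.1 1)) (fun ω => ω.2.2 0) (fun ω => (ω.2.1 2, ω.1)))
      (condMutualInfo (W.timeSharingLaw pQ pX)
        (fun ω => (ω.2.1 0, ω.2.1 1)) (fun ω => ω.2.2 1) (fun ω => (ω.2.1 2, ω.1))) ∧
    R 2 + R 0 < condMutualInfo (W.timeSharingLaw pQ pX)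
      (fun ω => (ω.2.1 2, ω.2.1 0)) (fun ω => ω.2.2 2) (fun ω => (ω.2.1 1, ω.1))}

/-- The nonnegative triples that satisfy the same rate bounds with `≤` in place of `<`. -/
def closedRegion (W : DMIC X Y) : Set (Fin 3 → ℝ) :=
  {R | (∀ i, 0 ≤ R i) ∧
    ∃ (pQ : stdSimplex ℝ (Fin 7)) (pX : Fin 7 → ∀ i, stdSimplex ℝ (X i)),
    R 0 ≤ condMutualInfo (W.timeSharingLaw pQ pX)
      (fun ω => ω.2.1 0) (fun ω => ω.2.2 0) (fun ω => (ω.2.1 1, ω.2.1 2, ω.1)) ∧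
    R 1 ≤ condMutualInfo (W.timeSharingLaw pQ pX)
      (fun ω => ω.2.1 1) (fun ω => ω.2.2 1) (fun ω => (ω.2.1 2, ω.2.1 0, ω.1)) ∧
    R 2 ≤ condMutualInfo (W.timeSharingLaw pQ pX)
      (fun ω => ω.2.1 2) (fun ω => ω.2.2 2) (fun ω => (ω.2.1 0, ω.2.1 1, ω.1)) ∧
    R 0 + R 1 ≤ min
      (condMutualInfo (W.timeSharingLaw pQ pX)
        (fun ω => (ω.2.1 0, ω.2.1 1)) (fun ω => ω.2.2 0) (fun ω => (ω.2.1 2, ω.1)))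
      (condMutualInfo (W.timeSharingLaw pQ pX)
        (fun ω => (ω.2.1 0, ω.2.1 1)) (fun ω => ω.2.2 1) (fun ω => (ω.2.1 2, ω.1))) ∧
    R 2 + R 0 ≤ condMutualInfo (W.timeSharingLaw pQ pX)
      (fun ω => (ω.2.1 2, ω.2.1 0)) (fun ω => ω.2.2 2) (fun ω => (ω.2.1 1, ω.1))}

end DMIC

/-! Every mutual information here is a difference of conditional entropies of one output given the
inputs of a set `T` of users (`outEnt`), and a time-sharing variable only averages these
differences.

Achievability: let every receiver decode all three messages. One random codebook with an i.i.d.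
time-sharing sequence then serves three multiple access channels, and the rates are achievable if,
for each receiver `j` and each nonempty set `S` of users, the sum of the rates over `S` is below
I[X_S; Y_j | X_{Sᶜ}, Q] (`achievable_of_lt`). The interference conditions make the stated bounds
imply these 21 inequalities, with `≤` (`sum_mul_le_of_mem_boundedRegion`). A very strong interferer
can be decoded with the other users as noise, so its rate may be added to a bound for the others; a
strong interferer can be decoded once the others are known; and knowing independent inputs never
hurts (`outEnt_submodular`). Scaling the rates by `r < 1` gives strictness.

Converse: Fano's inequality bounds each message. In the sum bound for users `k`, `l` at receiver
`k`, that receiver takes the place of receiver `l`: I[W_l; Y_lⁿ | other messages] ≤ I[W_l; Y_kⁿ |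
other messages], and the chain rule adds the information about W_k. The hypothesis gives this only
for single letters; it passes to blocks because products preserve the more capable order
(`MoreCapable.prod`, `outEnt_messageChannel_sub_le`). Memorylessness bounds the block informations
by sums over letters. The average over the letters lies in the convex hull of bound vectors in ℝ⁶,
so by Carathéodory seven values of Q suffice. The region so obtained is closed, being a projection
along a compact space, and hence contains the limits of achievable triples. -/

set_option linter.unusedSectionVars false

/-! ### Finite sums against product laws -/

section FiniteSums

theorem lawOf_nonneg {Ω α : Type*} [Fintype Ω] {p : Ω → ℝ} (hp : ∀ ω, 0 ≤ p ω) (A : Ω → α) (a : α) :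
    0 ≤ lawOf p A a := by
  classical
  unfold lawOf
  exact Finset.sum_nonneg fun ω _ => by split_ifs <;> simp [hp]

theorem sum_lawOf_mul {Ω α : Type*} [Fintype Ω] [Fintype α] (p : Ω → ℝ) (A : Ω → α) (h : α → ℝ) :
    ∑ a, lawOf p A a * h a = ∑ ω, p ω * h (A ω) := by
  classical
  simp only [lawOf, Finset.sum_mul]
  rw [Finset.sum_comm]
  refine Finset.sum_congr rfl fun ω _ => ?_
  rw [Finset.sum_eq_single (A ω)] <;> simp +contextual [eq_comm]

theorem sum_lawOf {Ω α : Type*} [Fintype Ω] [Fintype α] (p : Ω → ℝ) (A : Ω → α) :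
    ∑ a, lawOf p A a = ∑ ω, p ω := by
  simpa using sum_lawOf_mul p A fun _ => 1

theorem lawOf_mem_stdSimplex {Ω α : Type*} [Fintype Ω] [Fintype α] {p : Ω → ℝ}
    (hp : p ∈ stdSimplex ℝ Ω) (A : Ω → α) : lawOf p A ∈ stdSimplex ℝ α :=
  ⟨fun a => lawOf_nonneg hp.1 A a, by rw [sum_lawOf, hp.2]⟩

variable {ι : Type*} [Fintype ι] [DecidableEq ι]

/-- Serves to pass from messages to letters, from the joint output to the output of one receiver,
and from free to pinned inputs. -/
theorem sum_prod_push {A U : ι → Type*} [∀ i, Fintype (A i)] [∀ i, Fintype (U i)]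
    (P : ∀ i, A i → ℝ) (φ : ∀ i, A i → U i) (F : (∀ i, U i) → ℝ) :
    ∑ a : ∀ i, A i, (∏ i, P i (a i)) * F (fun i => φ i (a i)) =
      ∑ u : ∀ i, U i, (∏ i, lawOf (P i) (φ i) (u i)) * F u := by
  classical
  simp only [lawOf, Fintype.prod_sum, Finset.sum_mul]
  rw [Finset.sum_comm]
  refine Finset.sum_congr rfl fun a _ => ?_
  rw [Finset.sum_eq_single (fun i => φ i (a i))]
  · simp
  · intro u _ hu
    obtain ⟨i, hi⟩ := Function.ne_iff.1 hu
    rw [Finset.prod_eq_zero (Finset.mem_univ i), zero_mul]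
    simp [Ne.symm hi]
  · simp

theorem sum_prod_transfer {A A' U : ι → Type*} [∀ i, Fintype (A i)] [∀ i, Fintype (A' i)]
    [∀ i, Fintype (U i)] (P : ∀ i, A i → ℝ) (φ : ∀ i, A i → U i) (P' : ∀ i, A' i → ℝ)
    (φ' : ∀ i, A' i → U i)
    (h : ∀ i (g : U i → ℝ), ∑ a, P i a * g (φ i a) = ∑ a, P' i a * g (φ' i a))
    (F : (∀ i, U i) → ℝ) :
    ∑ a : ∀ i, A i, (∏ i, P i (a i)) * F (fun i => φ i (a i)) =
      ∑ a : ∀ i, A' i, (∏ i, P' i (a i)) * F (fun i => φ' i (a i)) := by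
  classical
  rw [sum_prod_push, sum_prod_push]
  have : ∀ i u, lawOf (P i) (φ i) u = lawOf (P' i) (φ' i) u := fun i u => by
    simpa [lawOf] using h i fun v => if v = u then 1 else 0
  simp [this]

theorem sum_prod_eval {A : ι → Type*} [∀ i, Fintype (A i)] (P : ∀ i, A i → ℝ) (k : ι)
    (g : A k → ℝ) :
    ∑ a : ∀ i, A i, (∏ i, P i (a i)) * g (a k) =
      (∑ a, P k a * g a) * ∏ i ∈ Finset.univ.erase k, ∑ a, P i a := by
  classical
  -- The extra factor is `g` in coordinate `k` and `1` elsewhere; the cast only repairs the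
  -- dependent type.
  have h := Fintype.prod_sum (fun i (a : A i) => P i a * if h : i = k then g (h ▸ a) else 1)
  rw [← Finset.mul_prod_erase _ _ (Finset.mem_univ k)] at h
  simp only [Finset.prod_mul_distrib] at h
  have e1 : ∀ a : ∀ i, A i, (∏ i, if h : i = k then g (h ▸ a i) else 1) = g (a k) := fun a => by
    rw [Finset.prod_eq_single k] <;> simp +contextual
  have e2 : (∏ i ∈ Finset.univ.erase k, ∑ a, P i a * if h : i = k then g (h ▸ a) else 1) =
      ∏ i ∈ Finset.univ.erase k, ∑ a, P i a :=
    Finset.prod_congr rfl fun i hi => by simp [Finset.ne_of_mem_erase hi]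
  simp only [e1, e2] at h
  rw [← h]
  simp

theorem sum_prod_eval_of_sum_eq_one {A : ι → Type*} [∀ i, Fintype (A i)] (P : ∀ i, A i → ℝ)
    (hP : ∀ i, ∑ a, P i a = 1) (k : ι) (g : A k → ℝ) :
    ∑ a : ∀ i, A i, (∏ i, P i (a i)) * g (a k) = ∑ a, P k a * g a := by
  rw [sum_prod_eval]; simp [hP]

end FiniteSums

/-! ### Conditional output entropies of a multiple access channel -/

section MultipleAccess

variable {ι : Type*} [Fintype ι] [DecidableEq ι] {X : ι → Type*} [∀ i, Fintype (X i)]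
  {B : Type*} [Fintype B]

/-- The law of independent inputs with laws `p i`. -/
def prodLaw (p : ∀ i, X i → ℝ) (x : ∀ i, X i) : ℝ := ∏ i, p i (x i)

/-- The channel obtained from `V` by averaging the inputs of the users outside `T`. -/
def mix (V : (∀ i, X i) → B → ℝ) (p : ∀ i, X i → ℝ) (T : Finset ι) (x : ∀ i, X i) (b : B) : ℝ :=
  ∑ z, prodLaw p z * V (T.piecewise x z) b

/-- The conditional entropy, in nats, of the output of `V` given the inputs of the users in `T`. -/
noncomputable def outEnt (V : (∀ i, X i) → B → ℝ) (p : ∀ i, X i → ℝ) (T : Finset ι) : ℝ :=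
  ∑ x, prodLaw p x * ∑ b, Real.negMulLog (mix V p T x b)

variable {V : (∀ i, X i) → B → ℝ} {p : ∀ i, X i → ℝ}

theorem prodLaw_nonneg (hp : ∀ i, p i ∈ stdSimplex ℝ (X i)) (x : ∀ i, X i) : 0 ≤ prodLaw p x :=
  Finset.prod_nonneg fun i _ => (hp i).1 _

theorem sum_prodLaw (hp : ∀ i, p i ∈ stdSimplex ℝ (X i)) : ∑ x, prodLaw p x = 1 := by
  simp only [prodLaw]
  rw [← Fintype.prod_sum]
  simp [(hp _).2]

theorem prodLaw_mem_stdSimplex (hp : ∀ i, p i ∈ stdSimplex ℝ (X i)) :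
    prodLaw p ∈ stdSimplex ℝ (∀ i, X i) :=
  ⟨prodLaw_nonneg hp, sum_prodLaw hp⟩

theorem prodLaw_piecewise_mul (T : Finset ι) (x z : ∀ i, X i) :
    prodLaw p (T.piecewise x z) * prodLaw p (T.piecewise z x) = prodLaw p x * prodLaw p z := by
  simp only [prodLaw, ← Finset.prod_mul_distrib]
  refine Finset.prod_congr rfl fun i _ => ?_
  by_cases h : i ∈ T <;> simp [h, mul_comm]

/-- Exchanging the coordinates outside `T` between two independent copies is a measure-preserving
involution. It takes the place of conditioning on the inputs of `T`. -/
theorem sum_piecewise_swap (T : Finset ι) (F : (∀ i, X i) → (∀ i, X i) → ℝ) :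
    ∑ x, ∑ z, prodLaw p x * prodLaw p z * F x z =
      ∑ x, ∑ z, prodLaw p x * prodLaw p z * F (T.piecewise x z) (T.piecewise z x) := by
  let f : (∀ i, X i) × (∀ i, X i) → (∀ i, X i) × (∀ i, X i) :=
    fun u => (T.piecewise u.1 u.2, T.piecewise u.2 u.1)
  have hf : Function.Involutive f := fun u => by
    refine Prod.ext ?_ ?_ <;> funext i <;> by_cases h : i ∈ T <;> simp [f, h]
  have := Fintype.sum_equiv (hf.toPerm f)
    (fun u => prodLaw p u.1 * prodLaw p u.2 * F (T.piecewise u.1 u.2) (T.piecewise u.2 u.1))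
    (fun u => prodLaw p u.1 * prodLaw p u.2 * F u.1 u.2) (fun u => by
      simp [f, prodLaw_piecewise_mul])
  rw [Fintype.sum_prod_type, Fintype.sum_prod_type] at this
  exact this.symm

theorem mix_nonneg (hp : ∀ i, p i ∈ stdSimplex ℝ (X i)) (hV : ∀ x, V x ∈ stdSimplex ℝ B)
    (T : Finset ι) (x : ∀ i, X i) (b : B) : 0 ≤ mix V p T x b :=
  Finset.sum_nonneg fun z _ => mul_nonneg (prodLaw_nonneg hp z) ((hV _).1 b)

theorem sum_mix (hp : ∀ i, p i ∈ stdSimplex ℝ (X i)) (hV : ∀ x, V x ∈ stdSimplex ℝ B)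
    (T : Finset ι) (x : ∀ i, X i) : ∑ b, mix V p T x b = 1 := by
  unfold mix
  rw [Finset.sum_comm]
  simp only [← Finset.mul_sum, (hV _).2, mul_one, sum_prodLaw hp]

theorem mix_mem_stdSimplex (hp : ∀ i, p i ∈ stdSimplex ℝ (X i)) (hV : ∀ x, V x ∈ stdSimplex ℝ B)
    (T : Finset ι) (x : ∀ i, X i) : mix V p T x ∈ stdSimplex ℝ B :=
  ⟨mix_nonneg hp hV T x, sum_mix hp hV T x⟩

theorem mix_congr {T : Finset ι} {x x' : ∀ i, X i} (h : ∀ i ∈ T, x i = x' i) (b : B) :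
    mix V p T x b = mix V p T x' b := by
  unfold mix
  refine Finset.sum_congr rfl fun z _ => ?_
  congr 2
  funext i
  by_cases hi : i ∈ T <;> simp [hi, h]

theorem mix_univ (hp : ∀ i, p i ∈ stdSimplex ℝ (X i)) (x : ∀ i, X i) (b : B) :
    mix V p Finset.univ x b = V x b := by
  simp [mix, Finset.piecewise_univ, ← Finset.sum_mul, sum_prodLaw hp]

theorem mix_empty (x : ∀ i, X i) (b : B) :
    mix V p ∅ x b = ∑ z, prodLaw p z * V z b := by
  simp [mix]

/-- Tower property: `mix V p T` is the conditional expectation of `V` given the inputs of `T`, and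
`g` depends on these alone. -/
theorem sum_mul_eq_sum_mix_mul (hp : ∀ i, p i ∈ stdSimplex ℝ (X i)) (T : Finset ι) (b : B)
    (g : (∀ i, X i) → ℝ) (hg : ∀ x x', (∀ i ∈ T, x i = x' i) → g x = g x') :
    ∑ x, prodLaw p x * (V x b * g x) = ∑ x, prodLaw p x * (mix V p T x b * g x) := by
  have h := sum_piecewise_swap (p := p) T fun x _ => V x b * g x
  calc ∑ x, prodLaw p x * (V x b * g x)
      = ∑ x, ∑ z, prodLaw p x * prodLaw p z * (V x b * g x) := by
        refine Finset.sum_congr rfl fun x _ => ?_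
        simp only [mul_assoc, ← Finset.mul_sum, ← Finset.sum_mul, sum_prodLaw hp, one_mul]
    _ = _ := h
    _ = _ := by
        refine Finset.sum_congr rfl fun x _ => ?_
        simp only [mix, Finset.sum_mul, Finset.mul_sum]
        refine Finset.sum_congr rfl fun z _ => ?_
        rw [hg (T.piecewise x z) x fun i hi => by simp [hi]]
        ring

theorem prodLaw_mul_le_mix (hp : ∀ i, p i ∈ stdSimplex ℝ (X i)) (hV : ∀ x, V x ∈ stdSimplex ℝ B)
    (T : Finset ι) (x : ∀ i, X i) (b : B) : prodLaw p x * V x b ≤ mix V p T x b := by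
  have := Finset.single_le_sum (f := fun z => prodLaw p z * V (T.piecewise x z) b)
    (fun z _ => mul_nonneg (prodLaw_nonneg hp z) ((hV _).1 b)) (Finset.mem_univ x)
  have e : T.piecewise x x = x := by funext i; by_cases h : i ∈ T <;> simp [h]
  simpa only [mix, e] using this

/-- Positivity on the support is what allows logarithms of ratios to be split in each use of Gibbs'
inequality. -/
theorem mix_pos (hp : ∀ i, p i ∈ stdSimplex ℝ (X i)) (hV : ∀ x, V x ∈ stdSimplex ℝ B)
    (T : Finset ι) {x : ∀ i, X i} {b : B} (h : prodLaw p x * V x b ≠ 0) : 0 < mix V p T x b :=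
  (lt_of_le_of_ne (mul_nonneg (prodLaw_nonneg hp x) ((hV _).1 b)) h.symm).trans_le
    (prodLaw_mul_le_mix hp hV T x b)

/-- By the tower property the entropies for all `T` become expectations under the same joint law, so
that Gibbs' inequality can compare them. -/
theorem outEnt_eq (hp : ∀ i, p i ∈ stdSimplex ℝ (X i)) (T : Finset ι) :
    outEnt V p T = -∑ x, prodLaw p x * ∑ b, V x b * Real.log (mix V p T x b) := by
  simp only [outEnt, Finset.mul_sum, Real.negMulLog]
  rw [Finset.sum_comm]
  conv_rhs => rw [Finset.sum_comm]
  rw [← Finset.sum_neg_distrib]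
  refine Finset.sum_congr rfl fun b _ => ?_
  rw [sum_mul_eq_sum_mix_mul hp T b (fun x => Real.log (mix V p T x b))
    fun x x' h => by rw [mix_congr h], ← Finset.sum_neg_distrib]
  exact Finset.sum_congr rfl fun x _ => by ring

theorem outEnt_univ (hp : ∀ i, p i ∈ stdSimplex ℝ (X i)) :
    outEnt V p Finset.univ = ∑ x, prodLaw p x * ∑ b, Real.negMulLog (V x b) := by
  simp [outEnt, mix_univ hp]

/-- Gibbs' inequality in the form `E log u ≤ E u - 1`. -/
theorem sum_mul_log_nonpos {Ω : Type*} [Fintype Ω] {P u : Ω → ℝ} (hP : P ∈ stdSimplex ℝ Ω)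
    (hu : ∀ ω, P ω ≠ 0 → 0 < u ω) (h : ∑ ω, P ω * u ω ≤ 1) : ∑ ω, P ω * Real.log (u ω) ≤ 0 := by
  have : ∑ ω, P ω * Real.log (u ω) ≤ ∑ ω, (P ω * u ω - P ω) := by
    refine Finset.sum_le_sum fun ω _ => ?_
    by_cases h0 : P ω = 0
    · simp [h0]
    · nlinarith [Real.log_le_sub_one_of_pos (hu ω h0), hP.1 ω]
  rw [Finset.sum_sub_distrib, hP.2] at this
  linarith

/-- The joint law of inputs and output. -/
theorem prodLaw_mul_mem_stdSimplex (hp : ∀ i, p i ∈ stdSimplex ℝ (X i))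
    (hV : ∀ x, V x ∈ stdSimplex ℝ B) :
    (fun u : (∀ i, X i) × B => prodLaw p u.1 * V u.1 u.2) ∈ stdSimplex ℝ ((∀ i, X i) × B) := by
  refine ⟨fun u => mul_nonneg (prodLaw_nonneg hp _) ((hV _).1 _), ?_⟩
  rw [Fintype.sum_prod_type]
  simp [← Finset.mul_sum, (hV _).2, sum_prodLaw hp]

theorem sum_mul_log_nonpos' (hp : ∀ i, p i ∈ stdSimplex ℝ (X i)) (hV : ∀ x, V x ∈ stdSimplex ℝ B)
    {u : (∀ i, X i) → B → ℝ} (hu : ∀ x b, prodLaw p x * V x b ≠ 0 → 0 < u x b)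
    (h : ∑ x, prodLaw p x * ∑ b, V x b * u x b ≤ 1) :
    ∑ x, prodLaw p x * ∑ b, V x b * Real.log (u x b) ≤ 0 := by
  have := sum_mul_log_nonpos (prodLaw_mul_mem_stdSimplex hp hV) (u := fun w => u w.1 w.2)
    (fun w => hu w.1 w.2) (by
      rw [Fintype.sum_prod_type]; simpa only [Finset.mul_sum, mul_assoc] using h)
  rw [Fintype.sum_prod_type] at this
  simpa only [Finset.mul_sum, mul_assoc] using this

/-- Functions of the inputs of disjoint sets of users are independent. -/
theorem sum_mul_eq_mul_sum_of_disjoint (hp : ∀ i, p i ∈ stdSimplex ℝ (X i)) {S T : Finset ι}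
    (hST : Disjoint S T) (f g : (∀ i, X i) → ℝ)
    (hf : ∀ x x', (∀ i ∈ S, x i = x' i) → f x = f x')
    (hg : ∀ x x', (∀ i ∈ T, x i = x' i) → g x = g x') :
    ∑ x, prodLaw p x * (f x * g x) = (∑ x, prodLaw p x * f x) * ∑ x, prodLaw p x * g x := by
  have h := sum_piecewise_swap (p := p) S fun x z => f x * g z
  have e1 : ∀ x z : ∀ i, X i, f (S.piecewise x z) = f x := fun x z =>
    hf _ _ fun i hi => by simp [hi]
  have e2 : ∀ x z : ∀ i, X i, g (S.piecewise z x) = g x := fun x z =>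
    hg _ _ fun i hi => by simp [Finset.disjoint_right.1 hST hi]
  simp only [e1, e2] at h
  rw [Finset.sum_mul_sum]
  calc _ = ∑ x, ∑ z, prodLaw p x * prodLaw p z * (f x * g x) := by
        refine Finset.sum_congr rfl fun x _ => ?_
        simp only [mul_assoc, ← Finset.mul_sum, ← Finset.sum_mul, sum_prodLaw hp, one_mul]
    _ = _ := h.symm
    _ = _ := Finset.sum_congr rfl fun x _ => Finset.sum_congr rfl fun z _ => by ring

/-- This is I[X_S; Y] ≤ I[X_S; Y | X_T] for independent inputs. Gibbs' inequality is applied to the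
ratio of mixtures below; its expectation is at most one because X_S and X_T are independent. -/
theorem outEnt_submodular (hp : ∀ i, p i ∈ stdSimplex ℝ (X i)) (hV : ∀ x, V x ∈ stdSimplex ℝ B)
    {S T : Finset ι} (hST : Disjoint S T) :
    outEnt V p (S ∪ T) + outEnt V p ∅ ≤ outEnt V p S + outEnt V p T := by
  have key := sum_mul_log_nonpos' hp hV
    (u := fun x b => mix V p S x b * mix V p T x b / (mix V p ∅ x b * mix V p (S ∪ T) x b))
    (fun x b h => by
      have := fun R => mix_pos hp hV R h
      exact div_pos (mul_pos (this _) (this _)) (mul_pos (this _) (this _))) ?_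
  · have e : ∀ x, prodLaw p x * ∑ b, V x b * Real.log
        (mix V p S x b * mix V p T x b / (mix V p ∅ x b * mix V p (S ∪ T) x b)) =
        prodLaw p x * (∑ b, V x b * Real.log (mix V p S x b)) +
        prodLaw p x * (∑ b, V x b * Real.log (mix V p T x b)) -
        prodLaw p x * (∑ b, V x b * Real.log (mix V p ∅ x b)) -
        prodLaw p x * (∑ b, V x b * Real.log (mix V p (S ∪ T) x b)) := fun x => by
      simp only [Finset.mul_sum, ← Finset.sum_sub_distrib, ← Finset.sum_add_distrib]
      refine Finset.sum_congr rfl fun b _ => ?_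
      by_cases h : prodLaw p x * V x b = 0
      · simp only [← mul_assoc, h]; ring
      · have := fun R => (mix_pos hp hV R h).ne'
        rw [Real.log_div (mul_ne_zero (this _) (this _)) (mul_ne_zero (this _) (this _)),
          Real.log_mul (this _) (this _), Real.log_mul (this _) (this _)]
        ring
    simp only [e, Finset.sum_add_distrib, Finset.sum_sub_distrib] at key
    simp only [outEnt_eq hp]
    linarith
  · have h1 : ∑ b, ∑ x, prodLaw p x * V x b = 1 := by
      rw [Finset.sum_comm]
      simp only [← Finset.mul_sum, (hV _).2, mul_one, sum_prodLaw hp]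
    simp only [Finset.mul_sum]
    rw [Finset.sum_comm, ← h1]
    refine Finset.sum_le_sum fun b _ => ?_
    set m := ∑ x, prodLaw p x * V x b with hm
    have hm0 : 0 ≤ m := Finset.sum_nonneg fun x _ => mul_nonneg (prodLaw_nonneg hp x) ((hV _).1 b)
    have he : ∀ x, mix V p ∅ x b = m := fun x => mix_empty x b
    have hs : ∀ R, ∑ x, prodLaw p x * mix V p R x b = m := fun R => by
      simpa using (sum_mul_eq_sum_mix_mul hp R b (fun _ => 1) fun _ _ _ => rfl).symm
    -- The ratio depends only on the inputs of `S ∪ T`, so `V` may be replaced by its mixture, which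
    -- cancels a factor of the denominator.
    rw [sum_mul_eq_sum_mix_mul hp (S ∪ T) b]
    · calc _ ≤ ∑ x, prodLaw p x * (mix V p S x b * mix V p T x b) / m := by
            refine Finset.sum_le_sum fun x _ => ?_
            rw [he, mul_div_assoc (prodLaw p x) (mix V p S x b * mix V p T x b)]
            refine mul_le_mul_of_nonneg_left ?_ (prodLaw_nonneg hp x)
            by_cases h0 : mix V p (S ∪ T) x b = 0
            · rw [h0, zero_mul]
              exact div_nonneg (mul_nonneg (mix_nonneg hp hV _ _ _) (mix_nonneg hp hV _ _ _)) hm0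
            · rw [mul_comm m, ← div_div, ← mul_div_assoc, mul_div_cancel₀ _ h0]
        _ = m * m / m := by
            rw [← Finset.sum_div, sum_mul_eq_mul_sum_of_disjoint hp hST
              (fun x => mix V p S x b) (fun x => mix V p T x b)
              (fun x x' h => mix_congr h b) (fun x x' h => mix_congr h b), hs, hs]
        -- For `m = 0` the quotient has the default value `0`, so no case distinction arises.
        _ ≤ m := by simp
    · intro x x' h
      rw [mix_congr h, mix_congr (T := S) fun i hi => h i (Finset.mem_union_left _ hi),
        mix_congr (T := T) fun i hi => h i (Finset.mem_union_right _ hi),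
        mix_congr (T := ∅) (x' := x') (by simp)]

end MultipleAccess

/-! ### Entropy as an expected logarithm; laws of pinned inputs -/

section Entropy

variable {Ω α β γ : Type*} [Fintype Ω] [Fintype α] [Fintype β] [Fintype γ]

theorem log_two_pos : 0 < Real.log 2 := Real.log_pos one_lt_two

theorem entropy_mul_log_two (p : Ω → ℝ) (A : Ω → α) :
    entropy p A * Real.log 2 = -∑ ω, p ω * Real.log (lawOf p A (A ω)) := by
  rw [entropy, div_mul_cancel₀ _ log_two_pos.ne', ← sum_lawOf_mul p A fun a => Real.log (lawOf p A a),
    ← Finset.sum_neg_distrib]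
  exact Finset.sum_congr rfl fun a _ => by rw [Real.negMulLog]; ring

end Entropy

section Agreement

variable {ι : Type*} [Fintype ι] [DecidableEq ι] {X : ι → Type*} [∀ i, Fintype (X i)]

open Classical in
-- Apply the coordinatewise map that pins the coordinates in `T` to those of `x`: the image law is a
-- point mass on `T` and unchanged elsewhere. This expresses the law of (X_T, Y) through `mix`.
theorem sum_ite_agree {p : ∀ i, X i → ℝ} (hp : ∀ i, p i ∈ stdSimplex ℝ (X i)) (T : Finset ι) (x : ∀ i, X i) (G : (∀ i, X i) → ℝ) :
    ∑ z, (if ∀ i ∈ T, z i = x i then prodLaw p z * G z else 0) =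
      (∏ i ∈ T, p i (x i)) * ∑ z, prodLaw p z * G (T.piecewise x z) := by
  have h := sum_prod_push p (fun i (a : X i) => if i ∈ T then x i else a) G
  have e : ∀ z : ∀ i, X i, (fun i => if i ∈ T then x i else z i) = T.piecewise x z := fun z => by
    funext i; by_cases h : i ∈ T <;> simp [h]
  simp only [e] at h
  simp only [prodLaw] at h ⊢
  rw [h, Finset.mul_sum]
  refine Finset.sum_congr rfl fun z _ => ?_
  have e1 : ∏ i ∈ T, p i (x i) = ∏ i, if i ∈ T then p i (x i) else 1 := by simp
  rw [e1, ← mul_assoc, ← Finset.prod_mul_distrib]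
  by_cases hz : ∀ i ∈ T, z i = x i
  · rw [if_pos hz]
    congr 1
    refine Finset.prod_congr rfl fun i _ => ?_
    by_cases hi : i ∈ T
    · simp [hi, lawOf, hz i hi, (hp i).2]
    · simp [hi, lawOf]
  · rw [if_neg hz]
    push Not at hz
    obtain ⟨i, hi, hne⟩ := hz
    rw [Finset.prod_eq_zero (Finset.mem_univ i), zero_mul]
    simp [hi, lawOf, Ne.symm hne]

end Agreement

/-! ### Mutual informations as differences of output entropies -/

section Entropies

variable {X Y : Fin 3 → Type*} [∀ i, Fintype (X i)] [∀ i, Fintype (Y i)]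

namespace DMIC

/-- The transition probability from the inputs to the output of receiver `j`. -/
noncomputable def outputLaw (W : DMIC X Y) (j : Fin 3) (x : ∀ i, X i) : Y j → ℝ :=
  lawOf (W.prob x) fun y => y j

theorem outputLaw_mem_stdSimplex (W : DMIC X Y) (j : Fin 3) (x : ∀ i, X i) :
    W.outputLaw j x ∈ stdSimplex ℝ (Y j) :=
  lawOf_mem_stdSimplex (W.prob_mem x) _

/-- The joint entropy, in nats, of independent inputs of the users in `T`. -/
noncomputable def inEnt (p : ∀ i, X i → ℝ) (T : Finset (Fin 3)) : ℝ :=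
  -∑ x, prodLaw p x * Real.log (∏ i ∈ T, p i (x i))

variable (W : DMIC X Y) (p : ∀ i, stdSimplex ℝ (X i))

theorem coe_mem_stdSimplex (i : Fin 3) : (p i : X i → ℝ) ∈ stdSimplex ℝ (X i) := (p i).2

theorem sum_jointLaw_mul (f : (∀ i, X i) → ℝ) :
    ∑ ω, W.jointLaw p ω * f ω.1 = ∑ x, prodLaw (fun i => (p i : X i → ℝ)) x * f x := by
  rw [Fintype.sum_prod_type]
  refine Finset.sum_congr rfl fun x _ => ?_
  simp only [jointLaw, ← Finset.sum_mul, ← Finset.mul_sum, (W.prob_mem x).2, mul_one]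
  rfl

theorem sum_jointLaw_mul_output (j : Fin 3) (f : (∀ i, X i) → Y j → ℝ) :
    ∑ ω, W.jointLaw p ω * f ω.1 (ω.2 j) =
      ∑ x, prodLaw (fun i => (p i : X i → ℝ)) x * ∑ b, W.outputLaw j x b * f x b := by
  rw [Fintype.sum_prod_type]
  refine Finset.sum_congr rfl fun x _ => ?_
  rw [outputLaw, sum_lawOf_mul]
  simp only [jointLaw, prodLaw, Finset.mul_sum, mul_assoc]

/-- Entropy depends only on the fibres of `A`, which `hA` describes; this covers every tupling and
ordering of the inputs. -/
theorem entropy_jointLaw_input {α : Type*} [Fintype α] (T : Finset (Fin 3))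
    (A : (∀ i, X i) × (∀ i, Y i) → α) (hA : ∀ u v, A u = A v ↔ ∀ i ∈ T, u.1 i = v.1 i) :
    entropy (W.jointLaw p) A * Real.log 2 = inEnt (fun i => (p i : X i → ℝ)) T := by
  classical
  rw [entropy_mul_log_two, inEnt, ← W.sum_jointLaw_mul p]
  congr 1
  refine Finset.sum_congr rfl fun u _ => ?_
  congr 2
  have h := sum_ite_agree (coe_mem_stdSimplex p) T u.1 fun _ => 1
  simp only [mul_one, sum_prodLaw (coe_mem_stdSimplex p)] at h
  rw [← h]
  have := W.sum_jointLaw_mul p fun x => if ∀ i ∈ T, x i = u.1 i then 1 else 0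
  simp only [mul_ite, mul_one, mul_zero] at this
  rw [← this]
  simp [lawOf, hA]

theorem entropy_jointLaw_output {α : Type*} [Fintype α] (T : Finset (Fin 3)) (j : Fin 3)
    (A : (∀ i, X i) × (∀ i, Y i) → α)
    (hA : ∀ u v, A u = A v ↔ (∀ i ∈ T, u.1 i = v.1 i) ∧ u.2 j = v.2 j) :
    entropy (W.jointLaw p) A * Real.log 2 = inEnt (fun i => (p i : X i → ℝ)) T +
      outEnt (W.outputLaw j) (fun i => (p i : X i → ℝ)) T := by
  classical
  rw [entropy_mul_log_two, inEnt, outEnt_eq (coe_mem_stdSimplex p), ← W.sum_jointLaw_mul p,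
    ← W.sum_jointLaw_mul_output p, ← neg_add, ← Finset.sum_add_distrib]
  congr 1
  refine Finset.sum_congr rfl fun u _ => ?_
  by_cases h0 : W.jointLaw p u = 0
  · simp [h0]
  have hl : lawOf (W.jointLaw p) A (A u) = (∏ i ∈ T, (p i : X i → ℝ) (u.1 i)) *
      mix (W.outputLaw j) (fun i => (p i : X i → ℝ)) T u.1 (u.2 j) := by
    rw [mix, ← sum_ite_agree (coe_mem_stdSimplex p) T u.1 fun x => W.outputLaw j x (u.2 j)]
    have := W.sum_jointLaw_mul_output p j fun x b =>
      if (∀ i ∈ T, x i = u.1 i) ∧ b = u.2 j then 1 else 0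
    simp only [lawOf, hA]
    simp only [mul_ite, mul_one, mul_zero] at this
    rw [this]
    refine Finset.sum_congr rfl fun x _ => ?_
    by_cases hx : ∀ i ∈ T, x i = u.1 i
    · simp only [eq_true hx, true_and, if_true]
      simp
    · simp only [eq_false hx, false_and, if_false, Finset.sum_const_zero, mul_zero]
  have hp0 : prodLaw (fun i => (p i : X i → ℝ)) u.1 ≠ 0 := fun h => h0 (by
    rw [jointLaw]; exact mul_eq_zero_of_left h _)
  have hm : 0 < mix (W.outputLaw j) (fun i => (p i : X i → ℝ)) T u.1 (u.2 j) := by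
    refine mix_pos (coe_mem_stdSimplex p) (W.outputLaw_mem_stdSimplex j) T (mul_ne_zero hp0 ?_)
    have h1 : W.prob u.1 u.2 ≤ W.outputLaw j u.1 (u.2 j) := by
      have := Finset.single_le_sum
        (f := fun y => if y j = u.2 j then W.prob u.1 y else 0)
        (fun y _ => by
          by_cases hy : y j = u.2 j
          · simpa [hy] using (W.prob_mem u.1).1 y
          · simp [hy]) (Finset.mem_univ u.2)
      simpa [outputLaw, lawOf] using this
    have h2 : W.prob u.1 u.2 ≠ 0 := fun h => h0 (by simp [jointLaw, h])
    exact ((lt_of_le_of_ne ((W.prob_mem u.1).1 _) h2.symm).trans_le h1).ne'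
  rw [hl, Real.log_mul _ hm.ne', mul_add]
  exact Finset.prod_ne_zero_iff.2 fun i _ => (Finset.prod_ne_zero_iff.1 hp0) i (Finset.mem_univ i)

/-- `A` and `C` together determine all inputs, so the input entropies of `T` and of all users each
occur with both signs and cancel. -/
theorem condMutualInfo_jointLaw {α γ : Type*} [Fintype α] [Fintype γ] (T : Finset (Fin 3))
    (j : Fin 3) (A : (∀ i, X i) × (∀ i, Y i) → α) (C : (∀ i, X i) × (∀ i, Y i) → γ)
    (hC : ∀ u v, C u = C v ↔ ∀ i ∈ T, u.1 i = v.1 i)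
    (hAC : ∀ u v, A u = A v ∧ C u = C v ↔ ∀ i, u.1 i = v.1 i) :
    condMutualInfo (W.jointLaw p) A (fun ω => ω.2 j) C * Real.log 2 =
      outEnt (W.outputLaw j) (fun i => (p i : X i → ℝ)) T -
        outEnt (W.outputLaw j) (fun i => (p i : X i → ℝ)) Finset.univ := by
  rw [condMutualInfo, sub_mul, sub_mul, add_mul,
    W.entropy_jointLaw_input p Finset.univ (fun ω => (A ω, C ω)) (fun u v => by simp [hAC]),
    W.entropy_jointLaw_output p T j (fun ω => (ω.2 j, C ω)) (fun u v => by
      simp [hC, and_comm]),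
    W.entropy_jointLaw_output p Finset.univ j (fun ω => (A ω, ω.2 j, C ω)) (fun u v => by
      simp only [Prod.mk.injEq, Finset.mem_univ, true_imp_iff, ← hAC]; tauto),
    W.entropy_jointLaw_input p T C hC]
  ring

theorem mutualInfo_jointLaw (k j : Fin 3) :
    mutualInfo (W.jointLaw p) (fun ω => ω.1 k) (fun ω => ω.2 j) * Real.log 2 =
      outEnt (W.outputLaw j) (fun i => (p i : X i → ℝ)) ∅ -
        outEnt (W.outputLaw j) (fun i => (p i : X i → ℝ)) {k} := by
  rw [mutualInfo, sub_mul, add_mul,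
    W.entropy_jointLaw_input p {k} (fun ω => ω.1 k) (fun u v => by simp),
    W.entropy_jointLaw_output p ∅ j (fun ω => ω.2 j) (fun u v => by simp),
    W.entropy_jointLaw_output p {k} j (fun ω => (ω.1 k, ω.2 j)) (fun u v => by simp)]
  simp only [inEnt, Finset.prod_empty, Real.log_one, mul_zero, Finset.sum_const_zero]
  ring

variable {𝒬 : Type*} [Fintype 𝒬] (pQ : stdSimplex ℝ 𝒬) (pX : 𝒬 → ∀ i, stdSimplex ℝ (X i))

theorem sum_jointLaw : ∑ ω, W.jointLaw p ω = 1 := by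
  simpa [sum_prodLaw (coe_mem_stdSimplex p)] using W.sum_jointLaw_mul p fun _ => 1

theorem jointLaw_nonneg (ω : (∀ i, X i) × (∀ i, Y i)) : 0 ≤ W.jointLaw p ω :=
  mul_nonneg (Finset.prod_nonneg fun i _ => (p i).2.1 _) ((W.prob_mem _).1 _)

/-- Chain rule H[A', Q] = H[Q] + H[A' | Q]. The term H[Q] cancels in every conditional mutual
information given Q. -/
theorem entropy_timeSharingLaw {α α' : Type*} [Fintype α] [Fintype α']
    (A : 𝒬 × (∀ i, X i) × (∀ i, Y i) → α) (A' : (∀ i, X i) × (∀ i, Y i) → α')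
    (hA : ∀ u v, A u = A v ↔ u.1 = v.1 ∧ A' u.2 = A' v.2) :
    entropy (W.timeSharingLaw pQ pX) A * Real.log 2 =
      ∑ q, Real.negMulLog ((pQ : 𝒬 → ℝ) q) +
        ∑ q, (pQ : 𝒬 → ℝ) q * (entropy (W.jointLaw (pX q)) A' * Real.log 2) := by
  classical
  simp only [entropy_mul_log_two]
  rw [Fintype.sum_prod_type, ← Finset.sum_neg_distrib, ← Finset.sum_add_distrib]
  refine Finset.sum_congr rfl fun q _ => ?_
  have hl : ∀ ω, lawOf (W.timeSharingLaw pQ pX) A (A (q, ω)) =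
      (pQ : 𝒬 → ℝ) q * lawOf (W.jointLaw (pX q)) A' (A' ω) := fun ω => by
    simp only [lawOf, Fintype.sum_prod_type (f := fun u : 𝒬 × (∀ i, X i) × (∀ i, Y i) => _), hA]
    rw [Finset.sum_eq_single q]
    · simp [timeSharingLaw, Finset.mul_sum]
    · intro q' _ h; simp [h]
    · simp
  have key : ∀ ω, W.timeSharingLaw pQ pX (q, ω) *
      Real.log (lawOf (W.timeSharingLaw pQ pX) A (A (q, ω))) =
      (pQ : 𝒬 → ℝ) q * Real.log ((pQ : 𝒬 → ℝ) q) * W.jointLaw (pX q) ω +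
      (pQ : 𝒬 → ℝ) q * (W.jointLaw (pX q) ω *
        Real.log (lawOf (W.jointLaw (pX q)) A' (A' ω))) := fun ω => by
    rw [hl, timeSharingLaw]
    by_cases h0 : (pQ : 𝒬 → ℝ) q = 0
    · simp [h0]
    by_cases h1 : W.jointLaw (pX q) ω = 0
    · simp [h1]
    rw [Real.log_mul h0]
    · ring
    · have := Finset.single_le_sum
        (f := fun ω' => if A' ω' = A' ω then W.jointLaw (pX q) ω' else 0)
        (fun ω' _ => by split_ifs <;> simp [jointLaw_nonneg]) (Finset.mem_univ ω)
      have h2 := (lt_of_le_of_ne (W.jointLaw_nonneg (pX q) ω) (Ne.symm h1)).trans_le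
        (by simpa [lawOf] using this)
      simpa [lawOf] using h2.ne'
  simp only [key, Finset.sum_add_distrib, ← Finset.mul_sum, sum_jointLaw, Real.negMulLog]
  ring

theorem condMutualInfo_timeSharingLaw {α γ γ' : Type*} [Fintype α] [Fintype γ] [Fintype γ']
    (T : Finset (Fin 3)) (j : Fin 3) (A : (∀ i, X i) × (∀ i, Y i) → α)
    (C : 𝒬 × (∀ i, X i) × (∀ i, Y i) → γ) (C' : (∀ i, X i) × (∀ i, Y i) → γ')
    (hCC : ∀ u v, C u = C v ↔ u.1 = v.1 ∧ C' u.2 = C' v.2)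
    (hC : ∀ u v, C' u = C' v ↔ ∀ i ∈ T, u.1 i = v.1 i)
    (hAC : ∀ u v, A u = A v ∧ C' u = C' v ↔ ∀ i, u.1 i = v.1 i) :
    condMutualInfo (W.timeSharingLaw pQ pX) (fun ω => A ω.2) (fun ω => ω.2.2 j) C * Real.log 2 =
      ∑ q, (pQ : 𝒬 → ℝ) q * (outEnt (W.outputLaw j) (fun i => (pX q i : X i → ℝ)) T -
        outEnt (W.outputLaw j) (fun i => (pX q i : X i → ℝ)) Finset.univ) := by
  simp only [← W.condMutualInfo_jointLaw _ T j A C' hC hAC]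
  rw [condMutualInfo, sub_mul, sub_mul, add_mul,
    W.entropy_timeSharingLaw pQ pX (fun ω => (A ω.2, C ω)) (fun ω => (A ω, C' ω))
      (fun u v => by simp only [Prod.mk.injEq, hCC]; tauto),
    W.entropy_timeSharingLaw pQ pX (fun ω => (ω.2.2 j, C ω)) (fun ω => (ω.2 j, C' ω))
      (fun u v => by simp only [Prod.mk.injEq, hCC]; tauto),
    W.entropy_timeSharingLaw pQ pX (fun ω => (A ω.2, ω.2.2 j, C ω)) (fun ω => (A ω, ω.2 j, C' ω))
      (fun u v => by simp only [Prod.mk.injEq, hCC]; tauto),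
    W.entropy_timeSharingLaw pQ pX C C' hCC]
  simp only [condMutualInfo, sub_mul, add_mul, mul_add, mul_sub, Finset.sum_add_distrib,
    Finset.sum_sub_distrib]
  ring

end DMIC

end Entropies

/-! ### Random coding for a compound multiple access channel -/

section RandomCoding

/-- Extracts one good codebook, or one good time-sharing sequence, from a bound on an average. -/
theorem exists_le_sum_mul {Ω : Type*} [Fintype Ω] {p : Ω → ℝ} (hp : p ∈ stdSimplex ℝ Ω)
    (f : Ω → ℝ) : ∃ ω, f ω ≤ ∑ ω, p ω * f ω := by
  by_contra! hcon
  obtain ⟨ω, -, hω⟩ := Finset.exists_ne_zero_of_sum_ne_zero (hp.2.trans_ne one_ne_zero)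
  have : ∑ ω, p ω * (∑ ω, p ω * f ω) < ∑ ω, p ω * f ω :=
    Finset.sum_lt_sum (fun c _ => mul_le_mul_of_nonneg_left (hcon c).le (hp.1 c))
      ⟨ω, Finset.mem_univ ω, mul_lt_mul_of_pos_left (hcon ω) (lt_of_le_of_ne (hp.1 ω) (Ne.symm hω))⟩
  rw [← Finset.sum_mul, hp.2, one_mul] at this
  exact lt_irrefl _ this

theorem sum_prod_eval_pair {A : Type*} [Fintype A] {m : ℕ} {P : A → ℝ} (hP : P ∈ stdSimplex ℝ A)
    (k l : Fin m) (g : A × A → ℝ) :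
    ∑ c : Fin m → A, (∏ t, P (c t)) * g (c k, c l) =
      ∑ u : A × A, P u.1 * P u.2 * g (u.1, if k = l then u.1 else u.2) := by
  classical
  rw [Fintype.sum_prod_type]
  by_cases hkl : k = l
  · subst hkl
    have := sum_prod_eval_of_sum_eq_one (fun (_ : Fin m) => P) (fun _ => hP.2) k fun a => g (a, a)
    simp only [this, if_true]
    refine Finset.sum_congr rfl fun a _ => ?_
    rw [← Finset.sum_mul, ← Finset.mul_sum, hP.2, mul_one]
  · have h1 : ∀ c : Fin m → A, (∏ t, P (c t)) * g (c k, c l) =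
        ∑ a, (∏ t, P (c t) * if t = k then (if c t = a then 1 else 0) else 1) * g (a, c l) := by
      intro c
      simp only [Finset.prod_mul_distrib, Finset.prod_ite_eq', Finset.mem_univ, if_true]
      simp
    simp only [h1]
    rw [Finset.sum_comm]
    refine Finset.sum_congr rfl fun a _ => ?_
    have := sum_prod_eval
      (fun (t : Fin m) b => P b * if t = k then (if b = a then 1 else 0) else 1) l fun b => g (a, b)
    rw [this, ← Finset.mul_prod_erase _ _ (Finset.mem_erase.2 ⟨hkl, Finset.mem_univ k⟩),
      Finset.prod_eq_one]
    · simp only [Ne.symm hkl, if_false, mul_one, if_true, mul_ite, mul_zero, Finset.sum_ite_eq',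
        Finset.mem_univ, Finset.sum_mul]
      exact Finset.sum_congr rfl fun b _ => by simp [hkl]; ring
    · intro t ht
      simp [Finset.ne_of_mem_erase ht, hP.2]

variable {ι : Type*} [Fintype ι] [DecidableEq ι] {X : ι → Type*} [∀ i, Fintype (X i)]
  {B : Type*} [Fintype B] {M : ι → ℕ}

/-- The codewords that the codebook `c` assigns to the messages `w`. -/
def codewords (c : ∀ i, Fin (M i) → X i) (w : ∀ i, Fin (M i)) (i : ι) : X i := c i (w i)

/-- The law of a random codebook with independent codewords. -/
def codebookLaw (p : ∀ i, X i → ℝ) (c : ∀ i, Fin (M i) → X i) : ℝ := ∏ i, ∏ m, p i (c i m)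

variable {V : (∀ i, X i) → B → ℝ} {p : ∀ i, X i → ℝ}

theorem codebookLaw_mem_stdSimplex (hp : ∀ i, p i ∈ stdSimplex ℝ (X i)) :
    codebookLaw (M := M) p ∈ stdSimplex ℝ (∀ i, Fin (M i) → X i) :=
  prodLaw_mem_stdSimplex (p := fun i (c : Fin (M i) → X i) => ∏ m, p i (c m)) fun i =>
    prodLaw_mem_stdSimplex (p := fun _ : Fin (M i) => p i) fun _ => hp i

/-- The codewords of `w` and `w'` coincide for the users whose messages agree and are independent
for the others. -/
theorem sum_codebookLaw_mul (hp : ∀ i, p i ∈ stdSimplex ℝ (X i)) (w w' : ∀ i, Fin (M i))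
    (F : (∀ i, X i) → (∀ i, X i) → ℝ) :
    ∑ c, codebookLaw p c * F (codewords c w) (codewords c w') =
      ∑ x, ∑ z, prodLaw p x * prodLaw p z *
        F x ((Finset.univ.filter fun i => w i = w' i).piecewise x z) := by
  have h := sum_prod_transfer (fun i (c : Fin (M i) → X i) => ∏ m, p i (c m))
    (fun i c => (c (w i), c (w' i))) (fun i (u : X i × X i) => p i u.1 * p i u.2)
    (fun i u => (u.1, if w i = w' i then u.1 else u.2))
    (fun i g => sum_prod_eval_pair (hp i) (w i) (w' i) g)
    (fun u => F (fun i => (u i).1) fun i => (u i).2)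
  refine h.trans ?_
  rw [← Fintype.sum_prod_type' (f := fun x z => prodLaw p x * prodLaw p z *
        F x ((Finset.univ.filter fun i => w i = w' i).piecewise x z))]
  refine Fintype.sum_equiv (Equiv.arrowProdEquivProdArrow _ X X) _ _ fun u => ?_
  simp only [Finset.prod_mul_distrib, prodLaw]
  congr 1
  congr 1
  funext i
  by_cases hi : w i = w' i <;> simp [hi, Equiv.arrowProdEquivProdArrow]

theorem sum_codebookLaw_mul_single (hp : ∀ i, p i ∈ stdSimplex ℝ (X i)) (w : ∀ i, Fin (M i))
    (F : (∀ i, X i) → ℝ) :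
    ∑ c, codebookLaw p c * F (codewords c w) = ∑ x, prodLaw p x * F x := by
  rw [sum_codebookLaw_mul hp w w fun x _ => F x]
  refine Finset.sum_congr rfl fun x _ => ?_
  simp only [mul_right_comm _ _ (F x)]
  rw [← Finset.mul_sum, sum_prodLaw hp, mul_one]

open Classical in
/-- The probability that the likelihood `V x b` is at most `κ` times the likelihood averaged over
the inputs of the users in `S`. -/
noncomputable def lowLikelihoodProb (V : (∀ i, X i) → B → ℝ) (p : ∀ i, X i → ℝ) (S : Finset ι)
    (κ : ℝ) : ℝ :=
  ∑ x, prodLaw p x * ∑ b, V x b * if V x b ≤ κ * mix V p Sᶜ x b then 1 else 0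

/-- The random coding bound of a threshold decoder. -/
noncomputable def decodingBound (V : (∀ i, X i) → B → ℝ) (p : ∀ i, X i → ℝ) (M : ι → ℕ)
    (K : Finset ι → ℝ) : ℝ :=
  ∑ S with S.Nonempty, (lowLikelihoodProb V p S (K S) + (∏ i ∈ S, ((M i : ℝ) - 1)) / K S)

open Classical in
/-- The union bound on the event that the threshold decoder errs. -/
noncomputable def unionBound (V : (∀ i, X i) → B → ℝ) (p : ∀ i, X i → ℝ) (K : Finset ι → ℝ)
    (c : ∀ i, Fin (M i) → X i) (w : ∀ i, Fin (M i)) (b : B) : ℝ :=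
  (∑ S with S.Nonempty,
    if V (codewords c w) b ≤ K S * mix V p Sᶜ (codewords c w) b then (1 : ℝ) else 0) +
  ∑ S with S.Nonempty, ∑ w' with ∀ i, i ∈ S ↔ w i ≠ w' i,
    if K S * mix V p Sᶜ (codewords c w') b < V (codewords c w') b then (1 : ℝ) else 0

open Classical in
-- The decoder returns any message tuple that passes the thresholds for all nonempty `S`. If it
-- errs, either the true tuple fails a threshold or a wrong tuple passes; wrong tuples are sorted by
-- the exact set `S` of users on which they differ from the true one.
theorem exists_decoder (hM : ∀ i, 0 < M i) (V : (∀ i, X i) → B → ℝ) (p : ∀ i, X i → ℝ)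
    (K : Finset ι → ℝ) (c : ∀ i, Fin (M i) → X i) :
    ∃ dec : B → ∀ i, Fin (M i), ∀ w b, (if dec b ≠ w then (1 : ℝ) else 0) ≤ unionBound V p K c w b := by
  have : ∀ b, ∃ d : ∀ i, Fin (M i), ∀ w, (if d ≠ w then (1 : ℝ) else 0) ≤ unionBound V p K c w b := by
    intro b
    have n1 : ∀ w : ∀ i, Fin (M i), ∀ S ∈ Finset.univ.filter fun S : Finset ι => S.Nonempty,
        (0 : ℝ) ≤ if V (codewords c w) b ≤ K S * mix V p Sᶜ (codewords c w) b then (1 : ℝ) else 0 :=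
      fun w S _ => by split_ifs <;> simp
    have n2 : ∀ w : ∀ i, Fin (M i), ∀ S : Finset ι,
        ∀ w' ∈ Finset.univ.filter fun w' : ∀ i, Fin (M i) => ∀ i, i ∈ S ↔ w i ≠ w' i,
        (0 : ℝ) ≤ if K S * mix V p Sᶜ (codewords c w') b < V (codewords c w') b then (1 : ℝ) else 0 :=
      fun w S w' _ => by split_ifs <;> simp
    have n3 : ∀ w : ∀ i, Fin (M i), 0 ≤ unionBound V p K c w b := fun w =>
      add_nonneg (Finset.sum_nonneg (n1 w))
        (Finset.sum_nonneg fun S _ => Finset.sum_nonneg (n2 w S))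
    have hbad : ∀ w : ∀ i, Fin (M i), (¬ ∀ S : Finset ι, S.Nonempty →
        K S * mix V p Sᶜ (codewords c w) b < V (codewords c w) b) → 1 ≤ unionBound V p K c w b := by
      intro w hw
      push Not at hw
      obtain ⟨S, hS, hle⟩ := hw
      have := Finset.single_le_sum (n1 w) (Finset.mem_filter.2 ⟨Finset.mem_univ S, hS⟩)
      rw [if_pos hle] at this
      exact this.trans (le_add_of_nonneg_right
        (Finset.sum_nonneg fun S _ => Finset.sum_nonneg (n2 w S)))
    by_cases h : ∃ w : ∀ i, Fin (M i), ∀ S : Finset ι, S.Nonempty →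
        K S * mix V p Sᶜ (codewords c w) b < V (codewords c w) b
    · obtain ⟨d, hd⟩ := h
      refine ⟨d, fun w => ?_⟩
      by_cases hdw : d = w
      · simpa [hdw] using n3 w
      rw [if_pos hdw]
      refine le_trans ?_ (le_add_of_nonneg_left (Finset.sum_nonneg (n1 w)))
      let S : Finset ι := Finset.univ.filter fun i => w i ≠ d i
      have hS : S.Nonempty := by
        obtain ⟨i, hi⟩ := Function.ne_iff.1 hdw
        exact ⟨i, by simpa [S] using Ne.symm hi⟩
      refine le_trans ?_ (Finset.single_le_sum
        (fun S _ => Finset.sum_nonneg (n2 w S)) (Finset.mem_filter.2 ⟨Finset.mem_univ S, hS⟩))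
      refine le_trans ?_ (Finset.single_le_sum (n2 w S)
        (Finset.mem_filter.2 ⟨Finset.mem_univ d, fun i => by simp [S]⟩))
      rw [if_pos (hd S hS)]
    · push Not at h
      -- When no tuple passes, the output is irrelevant: the true tuple fails too, so the union
      -- bound is at least one.
      refine ⟨fun i => ⟨0, hM i⟩, fun w => ?_⟩
      have := hbad w (by push Not; exact h w)
      split_ifs
      · exact this
      · exact zero_le_one.trans this
  choose dec h using this
  exact ⟨dec, fun w b => h b w⟩

theorem card_differ (S : Finset ι) (w : ∀ i, Fin (M i)) :
    ((Finset.univ.filter fun w' : ∀ i, Fin (M i) => ∀ i, i ∈ S ↔ w i ≠ w' i).card : ℝ) =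
      ∏ i ∈ S, ((M i : ℝ) - 1) := by
  have : (Finset.univ.filter fun w' : ∀ i, Fin (M i) => ∀ i, i ∈ S ↔ w i ≠ w' i) =
      Fintype.piFinset fun i => if i ∈ S then {w i}ᶜ else {w i} := by
    ext w'
    simp only [Finset.mem_filter, Finset.mem_univ, true_and, Fintype.mem_piFinset]
    refine forall_congr' fun i => ?_
    by_cases hi : i ∈ S <;> simp [hi, eq_comm]
  rw [this, Fintype.card_piFinset, Nat.cast_prod,
    ← Finset.prod_filter_mul_prod_filter_not Finset.univ (· ∈ S)]
  rw [Finset.prod_eq_one (s := Finset.univ.filter fun i => ¬ i ∈ S), mul_one]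
  · rw [Finset.filter_univ_mem]
    refine Finset.prod_congr rfl fun i hi => ?_
    have : 1 ≤ M i := (Nat.zero_le _).trans_lt (w i).2
    simp [hi, Finset.card_compl, Nat.cast_sub this]
  · intro i hi
    simp [(Finset.mem_filter.1 hi).2]

/-- Change of measure: given the inputs of `T`, the output is independent of the fresh inputs `z`
and has law `mix V p T`. Where the threshold is passed this law is below `V / κ`, and `V` sums to
one. -/
theorem sum_prodLaw_mul_threshold_le (hp : ∀ i, p i ∈ stdSimplex ℝ (X i))
    (hV : ∀ x, V x ∈ stdSimplex ℝ B) (T : Finset ι) {κ : ℝ} (hκ : 0 < κ)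
    [∀ x b, Decidable (κ * mix V p T x b < V x b)] :
    ∑ x, ∑ z, prodLaw p x * prodLaw p z * ∑ b, V x b *
      (if κ * mix V p T (T.piecewise x z) b < V (T.piecewise x z) b then 1 else 0) ≤ 1 / κ := by
  have e : ∀ x z : ∀ i, X i, ∀ b, mix V p T (T.piecewise x z) b = mix V p T x b := fun x z b =>
    mix_congr (fun i hi => by simp [hi]) b
  have h1 : ∑ x, ∑ z, prodLaw p x * prodLaw p z * ∑ b, V x b *
      (if κ * mix V p T (T.piecewise x z) b < V (T.piecewise x z) b then (1 : ℝ) else 0) =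
      ∑ z, prodLaw p z * ∑ b, ∑ x, prodLaw p x * (mix V p T x b *
        (if κ * mix V p T (T.piecewise x z) b < V (T.piecewise x z) b then 1 else 0)) := by
    rw [Finset.sum_comm]
    refine Finset.sum_congr rfl fun z _ => ?_
    simp only [mul_comm (prodLaw p _) (prodLaw p z), mul_assoc, ← Finset.mul_sum]
    congr 1
    simp only [Finset.mul_sum]
    rw [Finset.sum_comm]
    refine Finset.sum_congr rfl fun b _ => ?_
    refine sum_mul_eq_sum_mix_mul hp T b _ fun x x' h => ?_
    have : T.piecewise x z = T.piecewise x' z := by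
      funext i; by_cases hi : i ∈ T <;> simp [hi, h]
    simp only [this]
  rw [h1]
  calc _ ≤ ∑ z, prodLaw p z * ∑ b, ∑ x, prodLaw p x * (V (T.piecewise x z) b / κ) := by
        refine Finset.sum_le_sum fun z _ => mul_le_mul_of_nonneg_left ?_ (prodLaw_nonneg hp z)
        refine Finset.sum_le_sum fun b _ => Finset.sum_le_sum fun x _ =>
          mul_le_mul_of_nonneg_left ?_ (prodLaw_nonneg hp x)
        split_ifs with h
        · rw [e] at h
          rw [le_div_iff₀ hκ]; linarith
        · simpa using div_nonneg ((hV _).1 b) hκ.le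
    _ = 1 / κ := by
        have : ∀ z : ∀ i, X i, ∑ b, ∑ x, prodLaw p x * (V (T.piecewise x z) b / κ) = 1 / κ := by
          intro z
          rw [Finset.sum_comm]
          simp only [← Finset.mul_sum, ← Finset.sum_div, (hV _).2, ← Finset.sum_mul, sum_prodLaw hp,
            one_mul]
        simp only [this, ← Finset.sum_mul, sum_prodLaw hp, one_mul]

theorem sum_codebookLaw_mul_unionBound_le (hp : ∀ i, p i ∈ stdSimplex ℝ (X i))
    (hV : ∀ x, V x ∈ stdSimplex ℝ B) {K : Finset ι → ℝ} (hK : ∀ S, 0 < K S)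
    (w : ∀ i, Fin (M i)) :
    ∑ c, codebookLaw p c * ∑ b, V (codewords c w) b * unionBound V p K c w b ≤
      decodingBound V p M K := by
  classical
  have h1 : ∀ S, ∑ c : ∀ i, Fin (M i) → X i, codebookLaw p c * ∑ b, V (codewords c w) b *
      (if V (codewords c w) b ≤ K S * mix V p Sᶜ (codewords c w) b then (1 : ℝ) else 0) =
      lowLikelihoodProb V p S (K S) := fun S =>
    sum_codebookLaw_mul_single hp w fun x => ∑ b, V x b *
      (if V x b ≤ K S * mix V p Sᶜ x b then (1 : ℝ) else 0)
  have h2 : ∀ S, ∀ w' ∈ Finset.univ.filter fun w' : ∀ i, Fin (M i) => ∀ i, i ∈ S ↔ w i ≠ w' i,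
      ∑ c : ∀ i, Fin (M i) → X i, codebookLaw p c * ∑ b, V (codewords c w) b *
      (if K S * mix V p Sᶜ (codewords c w') b < V (codewords c w') b then (1 : ℝ) else 0) ≤
      1 / K S := fun S w' hw' => by
    have hS : (Finset.univ.filter fun i => w i = w' i) = Sᶜ := by
      ext i
      have := (Finset.mem_filter.1 hw').2 i
      simp only [Finset.mem_filter, Finset.mem_univ, true_and, Finset.mem_compl, this, not_not]
    rw [sum_codebookLaw_mul hp w w' fun x x' => ∑ b, V x b *
      (if K S * mix V p Sᶜ x' b < V x' b then (1 : ℝ) else 0), hS]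
    exact sum_prodLaw_mul_threshold_le hp hV Sᶜ (hK S)
  have h3 : ∑ c, codebookLaw p c * ∑ b, V (codewords c w) b * unionBound V p K c w b =
      ∑ S with S.Nonempty, ∑ c : ∀ i, Fin (M i) → X i, codebookLaw p c * ∑ b, V (codewords c w) b *
        (if V (codewords c w) b ≤ K S * mix V p Sᶜ (codewords c w) b then (1 : ℝ) else 0) +
      ∑ S with S.Nonempty, ∑ w' with ∀ i, i ∈ S ↔ w i ≠ w' i,
        ∑ c : ∀ i, Fin (M i) → X i, codebookLaw p c * ∑ b, V (codewords c w) b *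
        (if K S * mix V p Sᶜ (codewords c w') b < V (codewords c w') b then (1 : ℝ) else 0) := by
    have e1 : ∀ f : Finset ι → (∀ i, Fin (M i) → X i) → B → ℝ,
        ∑ S with S.Nonempty, ∑ c : ∀ i, Fin (M i) → X i, codebookLaw p c * ∑ b,
          V (codewords c w) b * f S c b = ∑ c : ∀ i, Fin (M i) → X i, codebookLaw p c * ∑ b,
          V (codewords c w) b * ∑ S with S.Nonempty, f S c b := fun f => by
      rw [Finset.sum_comm]
      refine Finset.sum_congr rfl fun c _ => ?_
      rw [← Finset.mul_sum, Finset.sum_comm]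
      simp only [Finset.mul_sum]
    have e2 : ∀ S : Finset ι, ∀ f : (∀ i, Fin (M i)) → (∀ i, Fin (M i) → X i) → B → ℝ,
        ∑ w' with ∀ i, i ∈ S ↔ w i ≠ w' i, ∑ c : ∀ i, Fin (M i) → X i, codebookLaw p c * ∑ b,
          V (codewords c w) b * f w' c b = ∑ c : ∀ i, Fin (M i) → X i, codebookLaw p c * ∑ b,
          V (codewords c w) b * ∑ w' with ∀ i, i ∈ S ↔ w i ≠ w' i, f w' c b := fun S f => by
      rw [Finset.sum_comm]
      refine Finset.sum_congr rfl fun c _ => ?_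
      rw [← Finset.mul_sum, Finset.sum_comm]
      simp only [Finset.mul_sum]
    rw [e1]
    simp only [e2]
    rw [e1, ← Finset.sum_add_distrib]
    refine Finset.sum_congr rfl fun c _ => ?_
    rw [← mul_add, ← Finset.sum_add_distrib]
    simp only [← mul_add]
    rfl
  rw [h3, decodingBound, Finset.sum_add_distrib]
  refine add_le_add (Finset.sum_le_sum fun S _ => (h1 S).le) (Finset.sum_le_sum fun S _ => ?_)
  refine (Finset.sum_le_sum (h2 S)).trans ?_
  rw [Finset.sum_const, nsmul_eq_mul, card_differ, mul_one_div]

open Classical in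
/-- One codebook serves all receivers of a compound multiple access channel. -/
theorem exists_codebook {J : Type*} [Fintype J] {B : J → Type*} [∀ j, Fintype (B j)]
    {V : ∀ j, (∀ i, X i) → B j → ℝ} (hM : ∀ i, 0 < M i) (hp : ∀ i, p i ∈ stdSimplex ℝ (X i))
    (hV : ∀ j x, V j x ∈ stdSimplex ℝ (B j)) {K : J → Finset ι → ℝ} (hK : ∀ j S, 0 < K j S) :
    ∃ (c : ∀ i, Fin (M i) → X i) (dec : ∀ j, B j → ∀ i, Fin (M i)),
      ∑ j, (∏ i, (M i : ℝ))⁻¹ * ∑ w, ∑ b, V j (codewords c w) b *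
        (if dec j b ≠ w then 1 else 0) ≤ ∑ j, decodingBound (V j) p M (K j) := by
  choose dec hdec using fun (c : ∀ i, Fin (M i) → X i) j =>
    exists_decoder hM (V j) p (K j) c
  -- The errors are summed over the receivers before averaging, so a single codebook is good for all
  -- of them at once.
  have havg : ∑ c, codebookLaw p c * ∑ j, (∏ i, (M i : ℝ))⁻¹ * ∑ w, ∑ b, V j (codewords c w) b *
        (if dec c j b ≠ w then 1 else 0) ≤ ∑ j, decodingBound (V j) p M (K j) := by
    calc _ ≤ ∑ c, codebookLaw p c * ∑ j, (∏ i, (M i : ℝ))⁻¹ * ∑ w, ∑ b, V j (codewords c w) b *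
            unionBound (V j) p (K j) c w b := by
          refine Finset.sum_le_sum fun c _ =>
            mul_le_mul_of_nonneg_left ?_ ((codebookLaw_mem_stdSimplex hp).1 c)
          refine Finset.sum_le_sum fun j _ => mul_le_mul_of_nonneg_left ?_ (by positivity)
          exact Finset.sum_le_sum fun w _ => Finset.sum_le_sum fun b _ =>
            mul_le_mul_of_nonneg_left (hdec c j w b) ((hV j _).1 b)
      _ = ∑ j, (∏ i, (M i : ℝ))⁻¹ * ∑ w, ∑ c, codebookLaw p c * ∑ b, V j (codewords c w) b *
            unionBound (V j) p (K j) c w b := by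
          simp only [Finset.mul_sum]
          rw [Finset.sum_comm]
          refine Finset.sum_congr rfl fun j _ => ?_
          rw [Finset.sum_comm]
          refine Finset.sum_congr rfl fun w _ => Finset.sum_congr rfl fun c _ =>
            Finset.sum_congr rfl fun b _ => by ring
      _ ≤ ∑ j, (∏ i, (M i : ℝ))⁻¹ * ∑ w : ∀ i, Fin (M i), decodingBound (V j) p M (K j) := by
          refine Finset.sum_le_sum fun j _ => mul_le_mul_of_nonneg_left ?_ (by positivity)
          exact Finset.sum_le_sum fun w _ => sum_codebookLaw_mul_unionBound_le hp (hV j) (hK j) w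
      _ = _ := by
          refine Finset.sum_congr rfl fun j _ => ?_
          have : (∏ i, (M i : ℝ)) ≠ 0 := Finset.prod_ne_zero_iff.2 fun i _ => by
            exact_mod_cast (hM i).ne'
          simp [Fintype.card_pi, this]
  obtain ⟨c, hc⟩ := exists_le_sum_mul (codebookLaw_mem_stdSimplex (M := M) hp)
    fun c => ∑ j, (∏ i, (M i : ℝ))⁻¹ * ∑ w, ∑ b, V j (codewords c w) b *
      (if dec c j b ≠ w then 1 else 0)
  exact ⟨c, dec c, hc.trans havg⟩

end RandomCoding

/-! ### Exponential decay over blocks with time sharing -/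

section Blocks

/-- At `s = 0` the sum equals one and its derivative is `a` minus the mean of `g`, which is
negative. -/
theorem exists_sum_mul_exp_lt_one {Ω : Type*} [Fintype Ω] {p : Ω → ℝ} (hp : p ∈ stdSimplex ℝ Ω)
    (g : Ω → ℝ) {a : ℝ} (ha : a < ∑ ω, p ω * g ω) :
    ∃ s : ℝ, 0 < s ∧ ∑ ω, p ω * Real.exp (-s * (g ω - a)) < 1 := by
  have hd : HasDerivAt (fun s : ℝ => ∑ ω, p ω * Real.exp (-s * (g ω - a)))
      (∑ ω, p ω * (Real.exp (-0 * (g ω - a)) * (-1 * (g ω - a)))) 0 :=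
    HasDerivAt.fun_sum fun ω _ => (((hasDerivAt_id (0 : ℝ)).neg.mul_const _).exp).const_mul _
  have hneg : ∑ ω, p ω * (Real.exp (-0 * (g ω - a)) * (-1 * (g ω - a))) < 0 := by
    have e : ∀ ω, p ω * (Real.exp (-0 * (g ω - a)) * (-1 * (g ω - a))) = a * p ω - p ω * g ω :=
      fun ω => by simp; ring
    simp only [e, Finset.sum_sub_distrib, ← Finset.mul_sum, hp.2]
    linarith
  have hslope := (hasDerivAt_iff_tendsto_slope_zero.1 hd).mono_left
    (nhdsWithin_mono (0 : ℝ) (s := Set.Ioi 0) (fun x hx => ne_of_gt hx))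
  obtain ⟨s, hs, hs0⟩ := ((hslope.eventually (gt_mem_nhds hneg)).and self_mem_nhdsWithin).exists
  refine ⟨s, hs0, ?_⟩
  have hs0' : (0 : ℝ) < s := hs0
  simp only [zero_add, neg_zero, zero_mul, Real.exp_zero, mul_one, hp.2, smul_eq_mul] at hs
  by_contra! hcon
  have := mul_nonneg (inv_nonneg.2 hs0'.le) (sub_nonneg.2 hcon)
  linarith

variable {ι : Type*} [Fintype ι] [DecidableEq ι] {X : ι → Type*} [∀ i, Fintype (X i)]
  {B : Type*} [Fintype B] {𝒬 : Type*} [Fintype 𝒬] {n : ℕ}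

/-- Independent letters of user `i`, the `t`-th of them with law `P t i`. -/
def blockLaw (P : Fin n → ∀ i, X i → ℝ) (i : ι) (x : Fin n → X i) : ℝ := ∏ t, P t i (x t)

/-- `n` uses of the memoryless channel `V`. -/
def blockChannel (V : (∀ i, X i) → B → ℝ) (x : ∀ i, Fin n → X i) (b : Fin n → B) : ℝ :=
  ∏ t, V (fun i => x i t) (b t)

variable {V : (∀ i, X i) → B → ℝ} {P : Fin n → ∀ i, X i → ℝ}

theorem blockLaw_mem_stdSimplex (hP : ∀ t i, P t i ∈ stdSimplex ℝ (X i)) (i : ι) :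
    blockLaw P i ∈ stdSimplex ℝ (Fin n → X i) :=
  prodLaw_mem_stdSimplex (p := fun t => P t i) fun t => hP t i

theorem blockChannel_mem_stdSimplex (hV : ∀ x, V x ∈ stdSimplex ℝ B) (x : ∀ i, Fin n → X i) :
    blockChannel V x ∈ stdSimplex ℝ (Fin n → B) :=
  prodLaw_mem_stdSimplex (p := fun t => V fun i => x i t) fun _ => hV _

theorem prodLaw_blockLaw (P : Fin n → ∀ i, X i → ℝ) (x : ∀ i, Fin n → X i) :
    prodLaw (blockLaw P) x = ∏ t, prodLaw (P t) fun i => x i t := by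
  simp only [prodLaw, blockLaw]
  exact Finset.prod_comm

theorem sum_prodLaw_blockLaw_mul (P : Fin n → ∀ i, X i → ℝ) (F : (Fin n → ∀ i, X i) → ℝ) :
    ∑ x, prodLaw (blockLaw P) x * F (fun t i => x i t) =
      ∑ x : Fin n → ∀ i, X i, (∏ t, prodLaw (P t) (x t)) * F x :=
  Fintype.sum_equiv (Equiv.piComm fun i (_ : Fin n) => X i) _ _ fun x => by
    rw [prodLaw_blockLaw]; rfl

theorem mix_blockChannel (T : Finset ι) (x : ∀ i, Fin n → X i) (b : Fin n → B) :
    mix (blockChannel V) (blockLaw P) T x b = ∏ t, mix V (P t) T (fun i => x i t) (b t) := by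
  simp only [mix]
  rw [Fintype.prod_sum]
  have h := sum_prodLaw_blockLaw_mul P fun z =>
    ∏ t, V (T.piecewise (fun i => x i t) (z t)) (b t)
  simp only [← Finset.prod_mul_distrib] at h
  rw [← h]
  refine Finset.sum_congr rfl fun z _ => ?_
  congr 1
  refine Finset.prod_congr rfl fun t _ => ?_
  congr 1
  funext i
  by_cases hi : i ∈ T <;> simp [hi]

theorem sum_log_likelihood_ratio {p : ∀ i, X i → ℝ} (hp : ∀ i, p i ∈ stdSimplex ℝ (X i))
    (T : Finset ι) :
    ∑ x, prodLaw p x * ∑ b, V x b * (Real.log (V x b) - Real.log (mix V p T x b)) =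
      outEnt V p T - outEnt V p Finset.univ := by
  simp only [outEnt_eq hp, mix_univ hp, mul_sub, Finset.sum_sub_distrib]
  ring

/-- Chernoff's bound. Averaging over an i.i.d. time-sharing sequence makes the triples (q_t, x_t,
b_t) i.i.d.; the mean of the log-likelihood ratio `g` is I[X_S; Y | X_{Sᶜ}, Q] > a, and `ρ` is the
mean of exp(-s (g - a)). -/
theorem exists_lowLikelihoodProb_le (hV : ∀ x, V x ∈ stdSimplex ℝ B) {pQ : 𝒬 → ℝ}
    (hQ : pQ ∈ stdSimplex ℝ 𝒬) {P : 𝒬 → ∀ i, X i → ℝ}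
    (hP : ∀ q i, P q i ∈ stdSimplex ℝ (X i)) (S : Finset ι) {a : ℝ}
    (ha : a < ∑ q, pQ q * (outEnt V (P q) Sᶜ - outEnt V (P q) Finset.univ)) :
    ∃ ρ : ℝ, 0 ≤ ρ ∧ ρ < 1 ∧ ∀ n : ℕ, ∑ qs : Fin n → 𝒬, (∏ t, pQ (qs t)) *
      lowLikelihoodProb (blockChannel V) (blockLaw fun t => P (qs t)) S (Real.exp (n * a)) ≤
        ρ ^ n := by
  classical
  let L : 𝒬 × (∀ i, X i) × B → ℝ := fun u => pQ u.1 * (prodLaw (P u.1) u.2.1 * V u.2.1 u.2.2)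
  let g : 𝒬 × (∀ i, X i) × B → ℝ := fun u =>
    Real.log (V u.2.1 u.2.2) - Real.log (mix V (P u.1) Sᶜ u.2.1 u.2.2)
  have hL : L ∈ stdSimplex ℝ _ := by
    refine ⟨fun u => mul_nonneg (hQ.1 _) ((prodLaw_mul_mem_stdSimplex (hP u.1) hV).1 u.2), ?_⟩
    rw [Fintype.sum_prod_type]
    have := fun q => (prodLaw_mul_mem_stdSimplex (hP q) hV).2
    simp only [L, ← Finset.mul_sum, this, mul_one, hQ.2]
  have hg : ∑ u, L u * g u =
      ∑ q, pQ q * (outEnt V (P q) Sᶜ - outEnt V (P q) Finset.univ) := by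
    simp only [← sum_log_likelihood_ratio (hP _)]
    rw [Fintype.sum_prod_type]
    refine Finset.sum_congr rfl fun q _ => ?_
    rw [Fintype.sum_prod_type, Finset.mul_sum]
    refine Finset.sum_congr rfl fun x _ => ?_
    simp only [Finset.mul_sum, L, g, mul_assoc]
  obtain ⟨s, hs, hlt⟩ := exists_sum_mul_exp_lt_one hL g (hg ▸ ha)
  refine ⟨_, Finset.sum_nonneg fun u _ => mul_nonneg (hL.1 u) (Real.exp_nonneg _), hlt, fun n => ?_⟩
  rw [Fintype.sum_pow]
  have hre : ∑ qs : Fin n → 𝒬, (∏ t, pQ (qs t)) *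
      lowLikelihoodProb (blockChannel V) (blockLaw fun t => P (qs t)) S (Real.exp (n * a)) =
      ∑ u : Fin n → 𝒬 × (∀ i, X i) × B, (∏ t, L (u t)) *
        if ∏ t, V (u t).2.1 (u t).2.2 ≤
          Real.exp (n * a) * ∏ t, mix V (P (u t).1) Sᶜ (u t).2.1 (u t).2.2 then 1 else 0 := by
    symm
    refine (Fintype.sum_equiv (Equiv.arrowProdEquivProdArrow (Fin n) (fun _ => 𝒬)
      fun _ => (∀ i, X i) × B) _ (fun u => (∏ t, L (u.1 t, u.2 t)) *
        if ∏ t, V (u.2 t).1 (u.2 t).2 ≤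
          Real.exp (n * a) * ∏ t, mix V (P (u.1 t)) Sᶜ (u.2 t).1 (u.2 t).2 then 1 else 0)
          (fun u => rfl)).trans ?_
    rw [Fintype.sum_prod_type]
    refine Finset.sum_congr rfl fun qs _ => ?_
    refine (Fintype.sum_equiv (Equiv.arrowProdEquivProdArrow (Fin n) (fun _ => ∀ i, X i)
      fun _ => B) _ (fun u => (∏ t, L (qs t, u.1 t, u.2 t)) *
        if ∏ t, V (u.1 t) (u.2 t) ≤
          Real.exp (n * a) * ∏ t, mix V (P (qs t)) Sᶜ (u.1 t) (u.2 t) then 1 else 0)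
          (fun u => rfl)).trans ?_
    rw [Fintype.sum_prod_type]
    have := sum_prodLaw_blockLaw_mul (fun t => P (qs t)) fun x => ∑ b : Fin n → B,
      (∏ t, V (x t) (b t)) * if ∏ t, V (x t) (b t) ≤
          Real.exp (n * a) * ∏ t, mix V (P (qs t)) Sᶜ (x t) (b t) then 1 else 0
    simp only [lowLikelihoodProb, mix_blockChannel, L, Finset.prod_mul_distrib, blockChannel]
    rw [this, Finset.mul_sum]
    refine Finset.sum_congr rfl fun x _ => ?_
    simp only [Finset.mul_sum, mul_assoc]
  rw [hre]
  refine Finset.sum_le_sum fun u _ => ?_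
  rw [Finset.prod_mul_distrib (f := fun t => L (u t))]
  by_cases h0 : ∏ t, L (u t) = 0
  · rw [h0, zero_mul, zero_mul]
  refine mul_le_mul_of_nonneg_left ?_ (Finset.prod_nonneg fun t _ => hL.1 _)
  have hne : ∀ t, L (u t) ≠ 0 := fun t => Finset.prod_ne_zero_iff.1 h0 t (Finset.mem_univ t)
  have hmix : ∀ t, 0 < mix V (P (u t).1) Sᶜ (u t).2.1 (u t).2.2 := fun t =>
    mix_pos (hP _) hV _ (right_ne_zero_of_mul (hne t))
  have hVpos : ∀ t, 0 < V (u t).2.1 (u t).2.2 := fun t =>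
    lt_of_le_of_ne ((hV _).1 _) (Ne.symm (right_ne_zero_of_mul (right_ne_zero_of_mul (hne t))))
  split_ifs with hle
  -- The low-likelihood event says that the sum of `g` over the block is at most `n * a`, so the
  -- exponential dominates the indicator.
  · rw [← Real.exp_sum]
    refine Real.one_le_exp ?_
    have h := Real.log_le_log (Finset.prod_pos fun t _ => hVpos t) hle
    rw [Real.log_mul (Real.exp_ne_zero _) (Finset.prod_pos fun t _ => hmix t).ne', Real.log_exp,
      Real.log_prod (fun t _ => (hVpos t).ne'), Real.log_prod (fun t _ => (hmix t).ne')] at h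
    rw [← Finset.mul_sum, Finset.sum_sub_distrib, Finset.sum_sub_distrib]
    simp only [Finset.sum_const, Finset.card_univ, Fintype.card_fin, nsmul_eq_mul]
    nlinarith
  · exact Finset.prod_nonneg fun t _ => Real.exp_nonneg _

end Blocks

/-! ### Achievability when every receiver decodes all messages -/

section Achievability

/-- A user of rate zero has exactly one message, so the product over a set containing it vanishes.
This is why wrong messages are counted by `M i - 1` and not by `M i`. -/
theorem prod_ceil_sub_one_div_exp_tendsto {ι : Type*} {S : Finset ι} {R : ι → ℝ} {a : ℝ}
    (h : (∃ i ∈ S, R i = 0) ∨ (∑ i ∈ S, R i) * Real.log 2 < a) :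
    Tendsto (fun n : ℕ => (∏ i ∈ S, ((⌈(2 : ℝ) ^ ((n : ℝ) * R i)⌉₊ : ℝ) - 1)) / Real.exp (n * a))
      atTop (𝓝 0) := by
  rcases h with ⟨i, hi, h0⟩ | h
  · refine tendsto_const_nhds.congr fun n => ?_
    rw [Finset.prod_eq_zero hi, zero_div]
    simp [h0]
  · have hlim : Tendsto (fun n : ℕ => Real.exp (-(a - (∑ i ∈ S, R i) * Real.log 2) ) ^ n)
        atTop (𝓝 0) :=
      tendsto_pow_atTop_nhds_zero_of_lt_one (Real.exp_nonneg _)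
        (Real.exp_lt_one_iff.2 (by linarith))
    have hnn : ∀ n : ℕ, ∀ i, 0 ≤ (⌈(2 : ℝ) ^ ((n : ℝ) * R i)⌉₊ : ℝ) - 1 := fun n i => by
      have : 1 ≤ ⌈(2 : ℝ) ^ ((n : ℝ) * R i)⌉₊ := Nat.one_le_ceil_iff.2 (by positivity)
      have : (1 : ℝ) ≤ ⌈(2 : ℝ) ^ ((n : ℝ) * R i)⌉₊ := by exact_mod_cast this
      linarith
    refine squeeze_zero (fun n => div_nonneg (Finset.prod_nonneg fun i _ => hnn n i)
      (Real.exp_nonneg _)) (fun n => ?_) hlim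
    rw [div_le_iff₀ (Real.exp_pos _), ← Real.exp_nat_mul, ← Real.exp_add]
    -- Since ⌈t⌉ - 1 < t, the product is at most 2 to the power n times the sum of the rates.
    calc _ ≤ ∏ i ∈ S, Real.exp (n * (R i * Real.log 2)) := by
          refine Finset.prod_le_prod (fun i _ => hnn n i) fun i _ => ?_
          have := Nat.ceil_lt_add_one (a := (2 : ℝ) ^ ((n : ℝ) * R i)) (by positivity)
          rw [show (n : ℝ) * (R i * Real.log 2) = Real.log 2 * (n * R i) by ring,
            ← Real.rpow_def_of_pos two_pos]
          linarith
      _ = _ := by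
          rw [← Real.exp_sum, ← Finset.mul_sum, ← Finset.sum_mul]
          congr 1
          ring

namespace DMIC

variable {X Y : Fin 3 → Type*} [∀ i, Fintype (X i)] [∀ i, Fintype (Y i)] (W : DMIC X Y)

theorem sum_prod_prob_mul {n : ℕ} (j : Fin 3) (x : ∀ i, Fin n → X i) (F : (Fin n → Y j) → ℝ) :
    ∑ y : Fin n → ∀ i, Y i, (∏ t, W.prob (fun i => x i t) (y t)) * F (fun t => y t j) =
      ∑ b, blockChannel (W.outputLaw j) x b * F b :=
  sum_prod_push (fun t => W.prob fun i => x i t) (fun _ y => y j) F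

open Classical in
-- Union bound over the receivers; each one is charged for an error in any message, although only
-- its own estimate counts.
theorem errorProb_le {n : ℕ} {M : Fin 3 → ℕ} (c : ∀ i, Fin (M i) → Fin n → X i)
    (dec : ∀ j, (Fin n → Y j) → ∀ i, Fin (M i)) :
    W.errorProb ⟨c, fun i y => dec i y i⟩ ≤ ∑ j, (∏ i, (M i : ℝ))⁻¹ * ∑ w, ∑ b,
      blockChannel (W.outputLaw j) (codewords c w) b * (if dec j b ≠ w then 1 else 0) := by
  rw [errorProb, ← Finset.mul_sum]
  refine mul_le_mul_of_nonneg_left ?_ (by positivity)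
  rw [Finset.sum_comm (s := (Finset.univ : Finset (Fin 3)))]
  refine Finset.sum_le_sum fun w _ => ?_
  simp only [← sum_prod_prob_mul]
  rw [Finset.sum_comm (s := (Finset.univ : Finset (Fin 3)))]
  refine Finset.sum_le_sum fun y _ => ?_
  have hnn : 0 ≤ ∏ t, W.prob (fun i => codewords c w i t) (y t) :=
    Finset.prod_nonneg fun t _ => (W.prob_mem _).1 _
  have hterm : ∀ j ∈ Finset.univ, 0 ≤ (∏ t, W.prob (fun i => codewords c w i t) (y t)) *
      (if dec j (fun t => y t j) ≠ w then (1 : ℝ) else 0) := fun j _ =>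
    mul_nonneg hnn (by split_ifs <;> simp)
  split_ifs with h
  · obtain ⟨j, hj⟩ := Function.ne_iff.1 h
    refine le_trans ?_ (Finset.single_le_sum hterm (Finset.mem_univ j))
    rw [if_pos fun h' => hj (congrFun h' j), mul_one]
    rfl
  · exact Finset.sum_nonneg hterm

/-- The thresholds are exp(n a) with `a` strictly between the rate sum and the information, so both
error terms decay. The alternative of a zero rate covers sets `S` whose information vanishes, where
no strict inequality is possible. -/
theorem achievable_of_lt {𝒬 : Type*} [Fintype 𝒬] (pQ : stdSimplex ℝ 𝒬)
    (pX : 𝒬 → ∀ i, stdSimplex ℝ (X i)) {R : Fin 3 → ℝ} (hR : ∀ i, 0 ≤ R i)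
    (h : ∀ j (S : Finset (Fin 3)), S.Nonempty → (∃ i ∈ S, R i = 0) ∨
      (∑ i ∈ S, R i) * Real.log 2 < ∑ q, (pQ : 𝒬 → ℝ) q *
        (outEnt (W.outputLaw j) (fun i => (pX q i : X i → ℝ)) Sᶜ -
          outEnt (W.outputLaw j) (fun i => (pX q i : X i → ℝ)) Finset.univ)) :
    W.Achievable R := by
  classical
  refine ⟨hR, ?_⟩
  have ha : ∀ j (S : Finset (Fin 3)), ∃ a, a < ∑ q, (pQ : 𝒬 → ℝ) q *
        (outEnt (W.outputLaw j) (fun i => (pX q i : X i → ℝ)) Sᶜ -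
          outEnt (W.outputLaw j) (fun i => (pX q i : X i → ℝ)) Finset.univ) ∧
      (S.Nonempty → (∃ i ∈ S, R i = 0) ∨ (∑ i ∈ S, R i) * Real.log 2 < a) := fun j S => by
    by_cases hS : S.Nonempty
    · rcases h j S hS with h0 | hlt
      · exact ⟨_, sub_one_lt _, fun _ => Or.inl h0⟩
      · obtain ⟨a, h1, h2⟩ := exists_between hlt
        exact ⟨a, h2, fun _ => Or.inr h1⟩
    · exact ⟨_, sub_one_lt _, fun h => absurd h hS⟩
  choose a ha1 ha2 using ha
  have hp : ∀ q i, (pX q i : X i → ℝ) ∈ stdSimplex ℝ (X i) := fun q i => (pX q i).2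
  choose ρ hρ0 hρ1 hρ using fun j S => exists_lowLikelihoodProb_le
    (W.outputLaw_mem_stdSimplex j) pQ.2 hp S (ha1 j S)
  let M : ℕ → Fin 3 → ℕ := fun n i => ⌈(2 : ℝ) ^ ((n : ℝ) * R i)⌉₊
  let K : ℕ → Fin 3 → Finset (Fin 3) → ℝ := fun n j S => Real.exp (n * a j S)
  have hcode : ∀ n : ℕ, ∃ C : InterferenceCode X Y (M n) n, W.errorProb C ≤
      ∑ j, ∑ S : Finset (Fin 3) with S.Nonempty,
        (ρ j S ^ n + (∏ i ∈ S, ((M n i : ℝ) - 1)) / K n j S) := fun n => by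
    -- The time-sharing sequence is fixed first, as one that is no worse than average for the sum
    -- over all receivers.
    obtain ⟨qs, hqs⟩ := exists_le_sum_mul
      (prodLaw_mem_stdSimplex (p := fun _ : Fin n => (pQ : 𝒬 → ℝ)) fun _ => pQ.2)
      fun qs => ∑ j, decodingBound (blockChannel (W.outputLaw j))
        (blockLaw fun t i => (pX (qs t) i : X i → ℝ)) (M n) (K n j)
    obtain ⟨c, dec, hc⟩ := exists_codebook (M := M n)
      (V := fun j => blockChannel (W.outputLaw j)) (K := K n)
      (fun i => Nat.ceil_pos.2 (by positivity))
      (blockLaw_mem_stdSimplex fun t i => hp (qs t) i)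
      (fun j => blockChannel_mem_stdSimplex (W.outputLaw_mem_stdSimplex j))
      (fun j S => Real.exp_pos _)
    refine ⟨⟨c, fun i y => dec i y i⟩, (W.errorProb_le c dec).trans (hc.trans (hqs.trans ?_))⟩
    simp only [Finset.mul_sum]
    rw [Finset.sum_comm]
    refine Finset.sum_le_sum fun j _ => ?_
    simp only [decodingBound, Finset.mul_sum]
    rw [Finset.sum_comm]
    refine Finset.sum_le_sum fun S _ => ?_
    simp only [mul_add, Finset.sum_add_distrib, ← Finset.sum_mul]
    rw [sum_prodLaw (p := fun _ : Fin n => (pQ : 𝒬 → ℝ)) fun _ => pQ.2, one_mul]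
    exact add_le_add (hρ j S n) le_rfl
  choose C hC using hcode
  refine ⟨C, squeeze_zero (fun n => ?_) hC ?_⟩
  · refine mul_nonneg (by positivity) (Finset.sum_nonneg fun w _ => Finset.sum_nonneg fun y _ => ?_)
    split_ifs
    · exact Finset.prod_nonneg fun t _ => (W.prob_mem _).1 _
    · exact le_rfl
  · rw [show (0 : ℝ) = ∑ j : Fin 3, ∑ S : Finset (Fin 3) with S.Nonempty, (0 + 0) by simp]
    refine tendsto_finsetSum _ fun j _ => tendsto_finsetSum _ fun S hS => Tendsto.add ?_ ?_
    · exact tendsto_pow_atTop_nhds_zero_of_lt_one (hρ0 j S) (hρ1 j S)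
    · exact prod_ceil_sub_one_div_exp_tendsto (ha2 j S (Finset.mem_filter.1 hS).2)

end DMIC

end Achievability

/-! ### Fano's inequality -/

section Fano

variable {ι : Type*} [Fintype ι] [DecidableEq ι] {X : ι → Type*} [∀ i, Fintype (X i)]
  {B : Type*} [Fintype B] {V : (∀ i, X i) → B → ℝ} {p : ∀ i, X i → ℝ}

theorem sum_prodLaw_mul_mix (hp : ∀ i, p i ∈ stdSimplex ℝ (X i)) (hV : ∀ x, V x ∈ stdSimplex ℝ B)
    (T : Finset ι) : ∑ b, ∑ x, prodLaw p x * mix V p T x b = 1 := by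
  rw [Finset.sum_comm]
  simp only [← Finset.mul_sum, sum_mix hp hV, mul_one, sum_prodLaw hp]

theorem sum_mul_mul_div_mix_le (hp : ∀ i, p i ∈ stdSimplex ℝ (X i))
    (T : Finset ι) (f : (∀ i, X i) → B → ℝ)
    (hf : ∀ x x' b, (∀ i ∈ T, x i = x' i) → f x b = f x' b) (hf0 : ∀ x b, 0 ≤ f x b) :
    ∑ x, prodLaw p x * ∑ b, V x b * (f x b / mix V p T x b) ≤ ∑ b, ∑ x, prodLaw p x * f x b := by
  simp only [Finset.mul_sum]
  rw [Finset.sum_comm]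
  refine Finset.sum_le_sum fun b _ => ?_
  rw [sum_mul_eq_sum_mix_mul hp T b _ fun x x' h => by rw [hf x x' b h, mix_congr h]]
  refine Finset.sum_le_sum fun x _ => mul_le_mul_of_nonneg_left ?_ (prodLaw_nonneg hp x)
  by_cases h0 : mix V p T x b = 0
  · simpa [h0] using hf0 x b
  · rw [mul_div_cancel₀ _ h0]

/-- Fano's inequality for a uniformly distributed input of user `k`. -/
theorem log_card_le_outEnt_sub (hp : ∀ i, p i ∈ stdSimplex ℝ (X i))
    (hV : ∀ x, V x ∈ stdSimplex ℝ B) {k : ι} [DecidableEq (X k)] {T : Finset ι} (hk : k ∈ T)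
    (hunif : ∀ a, p k a = (Fintype.card (X k) : ℝ)⁻¹) (dec : B → X k) :
    Real.log (Fintype.card (X k)) ≤ outEnt V p (T.erase k) - outEnt V p T + Real.log 2 +
      (∑ x, prodLaw p x * ∑ b, V x b * if dec b ≠ x k then 1 else 0) *
        Real.log (Fintype.card (X k)) := by
  set m : ℝ := (Fintype.card (X k) : ℝ) with hm
  have hne : Nonempty (X k) := by
    by_contra h
    rw [not_nonempty_iff] at h
    simpa using (hp k).2
  have hm0 : 0 < m := by rw [hm]; exact_mod_cast Fintype.card_pos
  -- A guess at the law of X_k given the output: mass 1/2 on the decoded value and 1/(2m) on each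
  -- other value, in total at most one. Its logarithm yields the terms log 2 and P(error) · log m.
  let q : (∀ i, X i) → B → ℝ := fun x b => if dec b ≠ x k then (2 * m)⁻¹ else 2⁻¹
  have hq0 : ∀ x b, 0 < q x b := fun x b => by
    simp only [q]; split_ifs <;> positivity
  have hlogq : ∀ x b, Real.log (q x b) =
      -Real.log 2 - (if dec b ≠ x k then 1 else 0) * Real.log m := fun x b => by
    simp only [q]
    split_ifs
    · rw [Real.log_inv, Real.log_mul two_ne_zero hm0.ne']; ring
    · rw [Real.log_inv]; ring
  have key := sum_mul_log_nonpos' hp hV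
    (u := fun x b => (q x b * m * mix V p (T.erase k) x b) / mix V p T x b)
    (fun x b h => div_pos (mul_pos (mul_pos (hq0 x b) hm0) (mix_pos hp hV _ h)) (mix_pos hp hV _ h))
    ?_
  · have e : ∀ x, prodLaw p x * ∑ b, V x b *
        Real.log ((q x b * m * mix V p (T.erase k) x b) / mix V p T x b) =
        prodLaw p x * (Real.log m - Real.log 2) -
        prodLaw p x * (∑ b, V x b * if dec b ≠ x k then 1 else 0) * Real.log m +
        prodLaw p x * (∑ b, V x b * Real.log (mix V p (T.erase k) x b)) -
        prodLaw p x * (∑ b, V x b * Real.log (mix V p T x b)) := fun x => by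
      have h1 : prodLaw p x * (Real.log m - Real.log 2) =
          ∑ b, prodLaw p x * (V x b * (Real.log m - Real.log 2)) := by
        rw [← Finset.mul_sum, ← Finset.sum_mul, (hV x).2, one_mul]
      rw [h1]
      simp only [Finset.mul_sum, Finset.sum_mul, ← Finset.sum_sub_distrib,
        ← Finset.sum_add_distrib]
      refine Finset.sum_congr rfl fun b _ => ?_
      by_cases h : prodLaw p x * V x b = 0
      · simp only [← mul_assoc, h]; ring
      · have := fun R => (mix_pos hp hV R h).ne'
        rw [Real.log_div (mul_ne_zero (mul_ne_zero (hq0 x b).ne' hm0.ne') (this _)) (this _),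
          Real.log_mul (mul_ne_zero (hq0 x b).ne' hm0.ne') (this _),
          Real.log_mul (hq0 x b).ne' hm0.ne', hlogq]
        ring
    simp only [e, Finset.sum_add_distrib, Finset.sum_sub_distrib, ← Finset.sum_mul,
      sum_prodLaw hp] at key
    simp only [outEnt_eq hp]
    linarith
  · refine (sum_mul_mul_div_mix_le hp T (fun x b => q x b * m * mix V p (T.erase k) x b)
      (fun x x' b h => ?_) fun x b => mul_nonneg (mul_nonneg (hq0 x b).le hm0.le)
        (mix_nonneg hp hV _ _ _)).trans ?_
    · simp only [q]
      rw [h k hk, mix_congr fun i hi => h i (Finset.mem_of_mem_erase hi)]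
    · rw [← sum_prodLaw_mul_mix hp hV (T.erase k)]
      refine Finset.sum_le_sum fun b _ => ?_
      rw [sum_mul_eq_mul_sum_of_disjoint hp (S := {k}) (T := T.erase k) (by simp)
        (fun x => q x b * m) (fun x => mix V p (T.erase k) x b)
        (fun x x' h => by simp only [q]; rw [h k (Finset.mem_singleton_self k)])
        fun x x' h => mix_congr h b]
      refine mul_le_of_le_one_left (Finset.sum_nonneg fun x _ =>
        mul_nonneg (prodLaw_nonneg hp x) (mix_nonneg hp hV _ _ _)) ?_
      have h1 := sum_prod_eval_of_sum_eq_one p (fun i => (hp i).2) k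
        fun a => (if dec b ≠ a then (2 * m)⁻¹ else 2⁻¹) * m
      have h2 : ∀ a, p k a * ((if dec b ≠ a then (2 * m)⁻¹ else 2⁻¹) * m) ≤
          (2 * m)⁻¹ + if dec b = a then 2⁻¹ else 0 := fun a => by
        rw [hunif, mul_comm _ m, inv_mul_cancel_left₀ hm0.ne']
        by_cases h : dec b = a
        · simp only [h, ne_eq, not_true_eq_false, if_false, if_true]
          have : 0 ≤ (2 * m)⁻¹ := by positivity
          linarith
        · simp [h]
      simp only [prodLaw, q]
      rw [h1]
      refine (Finset.sum_le_sum fun a _ => h2 a).trans ?_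
      rw [Finset.sum_add_distrib]
      simp only [Finset.sum_const, Finset.card_univ, nsmul_eq_mul, ← hm, Finset.sum_ite_eq,
        Finset.mem_univ, if_true]
      rw [mul_inv, mul_left_comm, mul_inv_cancel₀ hm0.ne']
      norm_num

end Fano

/-! ### From block entropies to single letters -/

section SingleLetter

variable {ι : Type*} [Fintype ι] [DecidableEq ι] {X : ι → Type*} [∀ i, Fintype (X i)]
  {B : Type*} [Fintype B] {V : (∀ i, X i) → B → ℝ} {M : ι → ℕ} {n : ℕ}
  {p : ∀ i, Fin (M i) → ℝ}

/-- The law of the `t`-th letter of the codeword of user `i`. -/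
noncomputable def letterLaw (p : ∀ i, Fin (M i) → ℝ) (c : ∀ i, Fin (M i) → Fin n → X i)
    (t : Fin n) (i : ι) : X i → ℝ :=
  lawOf (p i) fun m => c i m t

/-- The channel from the messages to the output block. -/
def messageChannel (V : (∀ i, X i) → B → ℝ) (c : ∀ i, Fin (M i) → Fin n → X i)
    (w : ∀ i, Fin (M i)) : (Fin n → B) → ℝ :=
  blockChannel V (codewords c w)

theorem letterLaw_mem_stdSimplex (hp : ∀ i, p i ∈ stdSimplex ℝ (Fin (M i)))
    (c : ∀ i, Fin (M i) → Fin n → X i) (t : Fin n) (i : ι) :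
    letterLaw p c t i ∈ stdSimplex ℝ (X i) :=
  lawOf_mem_stdSimplex (hp i) _

theorem messageChannel_mem_stdSimplex (hV : ∀ x, V x ∈ stdSimplex ℝ B)
    (c : ∀ i, Fin (M i) → Fin n → X i) (w : ∀ i, Fin (M i)) :
    messageChannel V c w ∈ stdSimplex ℝ (Fin n → B) :=
  blockChannel_mem_stdSimplex hV _

theorem sum_messageChannel_mul (hV : ∀ x, V x ∈ stdSimplex ℝ B)
    (c : ∀ i, Fin (M i) → Fin n → X i) (t : Fin n) (g : (∀ i, X i) → B → ℝ) :
    ∑ w, prodLaw p w * ∑ b, messageChannel V c w b * g (fun i => codewords c w i t) (b t) =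
      ∑ x, prodLaw (letterLaw p c t) x * ∑ b, V x b * g x b := by
  have h := sum_prod_push p (fun i m => c i m t) fun x => ∑ b, V x b * g x b
  refine Eq.trans ?_ h
  refine Finset.sum_congr rfl fun w _ => ?_
  congr 1
  exact sum_prod_eval_of_sum_eq_one (fun s => V fun i => codewords c w i s) (fun s => (hV _).2) t
    fun b => g (fun i => codewords c w i t) b

theorem outEnt_messageChannel_univ (hp : ∀ i, p i ∈ stdSimplex ℝ (Fin (M i)))
    (hV : ∀ x, V x ∈ stdSimplex ℝ B) (c : ∀ i, Fin (M i) → Fin n → X i) :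
    outEnt (messageChannel V c) p Finset.univ =
      ∑ t, outEnt V (letterLaw p c t) Finset.univ := by
  have h : ∀ t, outEnt V (letterLaw p c t) Finset.univ = -∑ w, prodLaw p w *
      ∑ b, messageChannel V c w b * Real.log (V (fun i => codewords c w i t) (b t)) := fun t => by
    rw [sum_messageChannel_mul hV c t fun x b => Real.log (V x b),
      outEnt_eq (letterLaw_mem_stdSimplex hp c t)]
    simp only [mix_univ (letterLaw_mem_stdSimplex hp c t)]
  simp only [h]
  rw [outEnt_eq hp, Finset.sum_neg_distrib, Finset.sum_comm]
  congr 1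
  refine Finset.sum_congr rfl fun w _ => ?_
  rw [← Finset.mul_sum, Finset.sum_comm]
  congr 1
  refine Finset.sum_congr rfl fun b _ => ?_
  rw [← Finset.mul_sum, mix_univ hp]
  by_cases h0 : messageChannel V c w b = 0
  · simp [h0]
  · congr 1
    exact Real.log_prod (Finset.prod_ne_zero_iff.1
      (show ∏ t, V (fun i => codewords c w i t) (b t) ≠ 0 from h0))

theorem prodLaw_letterLaw_ne_zero (hp : ∀ i, p i ∈ stdSimplex ℝ (Fin (M i)))
    (c : ∀ i, Fin (M i) → Fin n → X i) (t : Fin n) {w : ∀ i, Fin (M i)} (hw : prodLaw p w ≠ 0) :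
    prodLaw (letterLaw p c t) (fun i => codewords c w i t) ≠ 0 := by
  classical
  refine Finset.prod_ne_zero_iff.2 fun i _ => ?_
  have hi : p i (w i) ≠ 0 := Finset.prod_ne_zero_iff.1 hw i (Finset.mem_univ i)
  have := Finset.single_le_sum
    (f := fun m => if c i m t = codewords c w i t then p i m else 0)
    (fun m _ => by split_ifs; exacts [(hp i).1 m, le_rfl]) (Finset.mem_univ (w i))
  have h2 := (lt_of_le_of_ne ((hp i).1 (w i)) hi.symm).trans_le (by simpa [codewords] using this)
  simpa [letterLaw, lawOf, codewords] using h2.ne'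

/-- Gibbs' inequality against the product `f` of one-letter mixtures, which depends only on the
messages of `T` and sums to one over the output block. This gives subadditivity and the passage from
messages to letters in one step. -/
theorem outEnt_messageChannel_le (hp : ∀ i, p i ∈ stdSimplex ℝ (Fin (M i)))
    (hV : ∀ x, V x ∈ stdSimplex ℝ B) (c : ∀ i, Fin (M i) → Fin n → X i) (T : Finset ι) :
    outEnt (messageChannel V c) p T ≤ ∑ t, outEnt V (letterLaw p c t) T := by
  have hl := letterLaw_mem_stdSimplex (X := X) hp c
  have hmV := messageChannel_mem_stdSimplex hV c
  let f : (∀ i, Fin (M i)) → (Fin n → B) → ℝ := fun w b =>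
    ∏ t, mix V (letterLaw p c t) T (fun i => codewords c w i t) (b t)
  have hfpos : ∀ w b, prodLaw p w * messageChannel V c w b ≠ 0 → ∀ t,
      0 < mix V (letterLaw p c t) T (fun i => codewords c w i t) (b t) := fun w b h t =>
    mix_pos (hl t) hV T (mul_ne_zero (prodLaw_letterLaw_ne_zero hp c t (left_ne_zero_of_mul h))
      (Finset.prod_ne_zero_iff.1 (right_ne_zero_of_mul h) t (Finset.mem_univ t)))
  have key := sum_mul_log_nonpos' hp hmV
    (u := fun w b => f w b / mix (messageChannel V c) p T w b)
    (fun w b h => div_pos (Finset.prod_pos fun t _ => hfpos w b h t) (mix_pos hp hmV T h)) ?_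
  · have h : ∀ t, outEnt V (letterLaw p c t) T = -∑ w, prodLaw p w *
        ∑ b, messageChannel V c w b *
          Real.log (mix V (letterLaw p c t) T (fun i => codewords c w i t) (b t)) := fun t => by
      rw [sum_messageChannel_mul hV c t fun x b => Real.log (mix V (letterLaw p c t) T x b),
        outEnt_eq (hl t)]
    have e : ∀ w, prodLaw p w * ∑ b, messageChannel V c w b *
        Real.log (f w b / mix (messageChannel V c) p T w b) =
        (∑ t, prodLaw p w * ∑ b, messageChannel V c w b *
          Real.log (mix V (letterLaw p c t) T (fun i => codewords c w i t) (b t))) -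
        prodLaw p w * ∑ b, messageChannel V c w b *
          Real.log (mix (messageChannel V c) p T w b) := fun w => by
      rw [← Finset.mul_sum, Finset.sum_comm]
      simp only [Finset.mul_sum, ← Finset.sum_sub_distrib]
      refine Finset.sum_congr rfl fun b _ => ?_
      by_cases h : prodLaw p w * messageChannel V c w b = 0
      · simp only [← mul_assoc, h, zero_mul, Finset.sum_const_zero, sub_zero]
      · rw [Real.log_div (Finset.prod_pos fun t _ => hfpos w b h t).ne' (mix_pos hp hmV T h).ne',
          Real.log_prod fun t _ => (hfpos w b h t).ne', mul_sub, mul_sub]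
        simp only [Finset.mul_sum]
    simp only [e, Finset.sum_sub_distrib] at key
    rw [Finset.sum_comm] at key
    simp only [h, Finset.sum_neg_distrib]
    rw [outEnt_eq hp]
    linarith
  · refine (sum_mul_mul_div_mix_le hp T f (fun w w' b h => ?_) fun w b =>
      Finset.prod_nonneg fun t _ => mix_nonneg (hl t) hV _ _ _).trans_eq ?_
    · refine Finset.prod_congr rfl fun t _ => mix_congr (fun i hi => ?_) _
      simp only [codewords, h i hi]
    · rw [Finset.sum_comm]
      have h1 : ∀ w, ∑ b, f w b = 1 := fun w =>
        sum_prodLaw (p := fun t => mix V (letterLaw p c t) T fun i => codewords c w i t)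
          fun t => mix_mem_stdSimplex (hl t) hV T _
      simp only [← Finset.mul_sum, h1, mul_one, sum_prodLaw hp]

end SingleLetter

/-! ### The more capable order is preserved by products -/

section MoreCapable

/-- The mutual information, in nats, of the input and the output of `K` for the input law `μ`,
extended to unnormalized `μ` as a homogeneous function. -/
noncomputable def inputInfo {A B : Type*} [Fintype A] [Fintype B] (μ : A → ℝ) (K : A → B → ℝ) : ℝ :=
  ∑ b, Real.negMulLog (∑ a, μ a * K a b) - Real.negMulLog (∑ a, μ a) -
    ∑ a, μ a * ∑ b, Real.negMulLog (K a b)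

/-- For every input law `K'` conveys at least as much information as `K`. -/
def MoreCapable {A B B' : Type*} [Fintype A] [Fintype B] [Fintype B'] (K' : A → B' → ℝ)
    (K : A → B → ℝ) : Prop :=
  ∀ μ : A → ℝ, (∀ a, 0 ≤ μ a) → inputInfo μ K ≤ inputInfo μ K'

variable {A B B' C C' : Type*} [Fintype A] [Fintype B] [Fintype B'] [Fintype C] [Fintype C']

theorem inputInfo_smul (r : ℝ) (μ : A → ℝ) {K : A → B → ℝ} (hK : ∀ a, K a ∈ stdSimplex ℝ B) :
    inputInfo (fun a => r * μ a) K = r * inputInfo μ K := by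
  have h1 : ∑ b, ∑ a, μ a * K a b = ∑ a, μ a := by
    rw [Finset.sum_comm]
    simp only [← Finset.mul_sum, (hK _).2, mul_one]
  simp only [inputInfo, mul_assoc, ← Finset.mul_sum, Real.negMulLog_mul, Finset.sum_add_distrib,
    ← Finset.sum_mul, h1]
  ring

theorem moreCapable_of_stdSimplex {K' : A → B' → ℝ} {K : A → B → ℝ}
    (hK' : ∀ a, K' a ∈ stdSimplex ℝ B') (hK : ∀ a, K a ∈ stdSimplex ℝ B)
    (h : ∀ μ ∈ stdSimplex ℝ A, inputInfo μ K ≤ inputInfo μ K') : MoreCapable K' K := by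
  intro μ hμ
  have hs : 0 ≤ ∑ a, μ a := Finset.sum_nonneg fun a _ => hμ a
  by_cases h0 : ∑ a, μ a = 0
  · have : μ = fun _ => 0 := funext fun a =>
      (Finset.sum_eq_zero_iff_of_nonneg fun a _ => hμ a).1 h0 a (Finset.mem_univ a)
    simp [this, inputInfo]
  · have e : μ = fun a => (∑ a, μ a) * ((∑ a, μ a)⁻¹ * μ a) := funext fun a => by
      rw [mul_inv_cancel_left₀ h0]
    rw [e, inputInfo_smul _ _ hK, inputInfo_smul _ _ hK']
    refine mul_le_mul_of_nonneg_left (h _ ⟨fun a => mul_nonneg (inv_nonneg.2 hs) (hμ a), ?_⟩) hs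
    rw [← Finset.mul_sum, inv_mul_cancel₀ h0]

theorem inputInfo_comp {A' : Type*} [Fintype A'] (μ : A' → ℝ) (f : A' → A) (K : A → B → ℝ) :
    inputInfo μ (fun a => K (f a)) = inputInfo (lawOf μ f) K := by
  simp only [inputInfo, sum_lawOf, sum_lawOf_mul μ f fun a => K a _,
    sum_lawOf_mul μ f fun a => ∑ b, Real.negMulLog (K a b)]

theorem MoreCapable.comp {A' : Type*} [Fintype A'] {K' : A → B' → ℝ} {K : A → B → ℝ}
    (h : MoreCapable K' K) (f : A' → A) : MoreCapable (fun a => K' (f a)) fun a => K (f a) :=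
  fun μ hμ => by
    rw [inputInfo_comp μ f K, inputInfo_comp μ f K']
    exact h _ (lawOf_nonneg hμ f)

/-- Chain rule I[A; B, C] = I[A; B] + I[A; C | B]. The term for `b` uses the unnormalized law of `A`
on the event B = b; homogeneity of `inputInfo` makes division by P(B = b) unnecessary. -/
theorem inputInfo_prod (μ : A → ℝ) {K : A → B → ℝ} {L : A → C → ℝ}
    (hK : ∀ a, K a ∈ stdSimplex ℝ B) (hL : ∀ a, L a ∈ stdSimplex ℝ C) :
    inputInfo μ (fun a (u : B × C) => K a u.1 * L a u.2) =
      inputInfo μ K + ∑ b, inputInfo (fun a => μ a * K a b) L := by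
  have h1 : ∀ a, ∑ b, ∑ c, Real.negMulLog (K a b * L a c) =
      ∑ b, Real.negMulLog (K a b) + ∑ c, Real.negMulLog (L a c) := fun a => by
    simp only [Real.negMulLog_mul, Finset.sum_add_distrib, ← Finset.mul_sum, ← Finset.sum_mul,
      (hK a).2, (hL a).2, one_mul]
  have h2 : ∑ b, ∑ a, μ a * K a b * ∑ c, Real.negMulLog (L a c) =
      ∑ a, μ a * ∑ c, Real.negMulLog (L a c) := by
    rw [Finset.sum_comm]
    simp only [← Finset.sum_mul, ← Finset.mul_sum, (hK _).2, mul_one]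
  simp only [inputInfo, Fintype.sum_prod_type, Finset.sum_sub_distrib, h1, mul_add,
    Finset.sum_add_distrib, mul_assoc]
  have h3 : ∀ b, ∑ a, μ a * (K a b * ∑ c, Real.negMulLog (L a c)) =
      ∑ a, μ a * K a b * ∑ c, Real.negMulLog (L a c) := fun b => by simp only [mul_assoc]
  simp only [h3, h2]
  ring

theorem inputInfo_prod_swap (μ : A → ℝ) (K : A → B → ℝ) (L : A → C → ℝ) :
    inputInfo μ (fun a (u : B × C) => K a u.1 * L a u.2) =
      inputInfo μ (fun a (u : C × B) => L a u.1 * K a u.2) := by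
  have h : ∀ F : B × C → ℝ, ∑ u, F u = ∑ u : C × B, F u.swap := fun F =>
    Fintype.sum_equiv (Equiv.prodComm B C) _ _ fun u => rfl
  unfold inputInfo
  simp only [h fun u => Real.negMulLog _, Prod.fst_swap, Prod.snd_swap, mul_comm (K _ _)]

/-- Replace one factor at a time: given the output of `K`, pass from `L` to `L'`; then exchange the
roles and, given the output of `L'`, pass from `K` to `K'`. -/
theorem MoreCapable.prod {K' : A → B' → ℝ} {K : A → B → ℝ} {L' : A → C' → ℝ} {L : A → C → ℝ}
    (hK' : ∀ a, K' a ∈ stdSimplex ℝ B') (hK : ∀ a, K a ∈ stdSimplex ℝ B)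
    (hL' : ∀ a, L' a ∈ stdSimplex ℝ C') (hL : ∀ a, L a ∈ stdSimplex ℝ C)
    (h : MoreCapable K' K) (h' : MoreCapable L' L) :
    MoreCapable (fun a (u : B' × C') => K' a u.1 * L' a u.2)
      (fun a (u : B × C) => K a u.1 * L a u.2) := by
  intro μ hμ
  calc _ = inputInfo μ K + ∑ b, inputInfo (fun a => μ a * K a b) L := inputInfo_prod μ hK hL
    _ ≤ inputInfo μ K + ∑ b, inputInfo (fun a => μ a * K a b) L' := by
        gcongr with b
        exact h' _ fun a => mul_nonneg (hμ a) ((hK a).1 b)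
    _ = inputInfo μ (fun a (u : C' × B) => L' a u.1 * K a u.2) := by
        rw [← inputInfo_prod μ hK hL', inputInfo_prod_swap]
    _ = inputInfo μ L' + ∑ b, inputInfo (fun a => μ a * L' a b) K := inputInfo_prod μ hL' hK
    _ ≤ inputInfo μ L' + ∑ b, inputInfo (fun a => μ a * L' a b) K' := by
        gcongr with b
        exact h _ fun a => mul_nonneg (hμ a) ((hL' a).1 b)
    _ = _ := by rw [← inputInfo_prod μ hL' hK', inputInfo_prod_swap]

theorem inputInfo_equiv (e : B ≃ C) (μ : A → ℝ) (K : A → C → ℝ) :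
    inputInfo μ (fun a b => K a (e b)) = inputInfo μ K := by
  unfold inputInfo
  rw [Equiv.sum_comp e fun c => Real.negMulLog (∑ a, μ a * K a c)]
  simp only [fun a => Equiv.sum_comp e fun c => Real.negMulLog (K a c)]

theorem MoreCapable.pi {n : ℕ} {K' : Fin n → A → B' → ℝ} {K : Fin n → A → B → ℝ}
    (hK' : ∀ t a, K' t a ∈ stdSimplex ℝ B') (hK : ∀ t a, K t a ∈ stdSimplex ℝ B)
    (h : ∀ t, MoreCapable (K' t) (K t)) :
    MoreCapable (fun a (b : Fin n → B') => ∏ t, K' t a (b t))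
      (fun a (b : Fin n → B) => ∏ t, K t a (b t)) := by
  induction n with
  | zero => intro μ _; simp [inputInfo]
  | succ n ih =>
    have := (h 0).prod (hK' 0) (hK 0)
      (fun a => prodLaw_mem_stdSimplex (p := fun t : Fin n => K' t.succ a) fun t => hK' _ a)
      (fun a => prodLaw_mem_stdSimplex (p := fun t : Fin n => K t.succ a) fun t => hK _ a)
      (ih (fun t => hK' t.succ) (fun t => hK t.succ) fun t => h t.succ)
    intro μ hμ
    have := this μ hμ
    rw [← inputInfo_equiv (Fin.consEquiv fun _ => B), ← inputInfo_equiv (Fin.consEquiv fun _ => B')]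
    simpa [Fin.prod_univ_succ, Fin.consEquiv, prodLaw] using this

end MoreCapable

/-! ### Comparison of receivers, from letters to blocks -/

section Tensorization

variable {ι : Type*} [Fintype ι] [DecidableEq ι] {X : ι → Type*} [∀ i, Fintype (X i)]
  {B B' : Type*} [Fintype B] [Fintype B'] {V : (∀ i, X i) → B → ℝ} {V' : (∀ i, X i) → B' → ℝ}
  {p : ∀ i, X i → ℝ}

theorem sum_prodLaw_update (hp : ∀ i, p i ∈ stdSimplex ℝ (X i)) (k : ι) (h : (∀ i, X i) → ℝ) :
    ∑ x, prodLaw p x * ∑ a, p k a * h (Function.update x k a) = ∑ x, prodLaw p x * h x := by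
  have e : ∀ x z : ∀ i, X i, (Finset.univ.erase k).piecewise x z = Function.update x k (z k) :=
    fun x z => by
      funext i
      by_cases hi : i = k
      · subst hi; simp
      · simp [hi]
  have h1 := sum_piecewise_swap (p := p) (Finset.univ.erase k) fun x _ => h x
  calc _ = ∑ x, ∑ z, prodLaw p x * prodLaw p z * h (Function.update x k (z k)) := by
        refine Finset.sum_congr rfl fun x _ => ?_
        simp only [mul_assoc, ← Finset.mul_sum]
        congr 1
        exact (sum_prod_eval_of_sum_eq_one p (fun i => (hp i).2) k
          fun a => h (Function.update x k a)).symm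
    _ = ∑ x, ∑ z, prodLaw p x * prodLaw p z * h x := by
        rw [h1]; simp only [e]
    _ = _ := by
        refine Finset.sum_congr rfl fun x _ => ?_
        simp only [mul_right_comm _ _ (h x)]
        rw [← Finset.mul_sum, sum_prodLaw hp, mul_one]

theorem mix_erase (hp : ∀ i, p i ∈ stdSimplex ℝ (X i)) (k : ι) (x : ∀ i, X i) (b : B) :
    mix V p (Finset.univ.erase k) x b = ∑ a, p k a * V (Function.update x k a) b := by
  rw [← sum_prod_eval_of_sum_eq_one p (fun i => (hp i).2) k
          fun a => V (Function.update x k a) b]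
  refine Finset.sum_congr rfl fun z _ => ?_
  congr 2
  funext i
  by_cases hi : i = k
  · subst hi; simp
  · simp [hi]

/-- Given the inputs of the other users, only the channel from user `k` remains, and the conditional
information is the average of its `inputInfo`. -/
theorem outEnt_erase_sub (hp : ∀ i, p i ∈ stdSimplex ℝ (X i)) (k : ι) :
    outEnt V p (Finset.univ.erase k) - outEnt V p Finset.univ =
      ∑ x, prodLaw p x * inputInfo (p k) fun a => V (Function.update x k a) := by
  simp only [inputInfo, (hp k).2, Real.negMulLog_one, sub_zero, mul_sub, Finset.sum_sub_distrib,
    sum_prodLaw_update hp k fun x => ∑ b, Real.negMulLog (V x b), outEnt_univ hp]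
  simp only [outEnt, mix_erase hp]

theorem moreCapable_of_outEnt_le (hV : ∀ x, V x ∈ stdSimplex ℝ B)
    (hV' : ∀ x, V' x ∈ stdSimplex ℝ B') (k : ι)
    (h : ∀ p : ∀ i, X i → ℝ, (∀ i, p i ∈ stdSimplex ℝ (X i)) →
      outEnt V p (Finset.univ.erase k) - outEnt V p Finset.univ ≤
        outEnt V' p (Finset.univ.erase k) - outEnt V' p Finset.univ) (x : ∀ i, X i) :
    MoreCapable (fun a => V' (Function.update x k a)) fun a => V (Function.update x k a) := by
  classical
  refine moreCapable_of_stdSimplex (fun a => hV' _) (fun a => hV _) fun μ hμ => ?_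
  -- Point masses at `x` for the other users turn the averaged comparison into one for the channel
  -- with these inputs frozen.
  let p : ∀ i, X i → ℝ := Function.update (fun i => Pi.single (x i) 1) k μ
  have hp : ∀ i, p i ∈ stdSimplex ℝ (X i) := fun i => by
    by_cases hi : i = k
    · subst hi; simpa [p] using hμ
    · simpa [p, hi] using single_mem_stdSimplex ℝ (x i)
  have e : ∀ G : (∀ i, X i) → ℝ, (∀ z, G (Function.update z k (x k)) = G z) →
      ∑ z, prodLaw p z * G z = G x := fun G hG => by
    have : ∀ z, prodLaw p z * G z = prodLaw p z * G x := fun z => by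
      by_cases hz : prodLaw p z = 0
      · simp [hz]
      · congr 1
        rw [← hG z]
        congr 1
        funext i
        by_cases hi : i = k
        · subst hi; simp
        · have h1 := Finset.prod_ne_zero_iff.1 hz i (Finset.mem_univ i)
          simp only [p, Function.update_of_ne hi] at h1 ⊢
          by_contra h2
          exact h1 (Pi.single_eq_of_ne h2 _)
    simp only [this, ← Finset.sum_mul, sum_prodLaw hp, one_mul]
  have := h p hp
  rw [outEnt_erase_sub hp, outEnt_erase_sub hp, e _ fun z => by simp, e _ fun z => by simp] at this
  simpa [p] using this

/-- Once the other messages are fixed, the block channel from the message of user `k` is a product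
over time of one-letter channels with the other letters frozen. The letters are dependent through
the message, so the comparison is needed for every input law of the product. -/
theorem outEnt_messageChannel_sub_le {M : ι → ℕ} {n : ℕ} (hV : ∀ x, V x ∈ stdSimplex ℝ B)
    (hV' : ∀ x, V' x ∈ stdSimplex ℝ B') (k : ι)
    (h : ∀ p : ∀ i, X i → ℝ, (∀ i, p i ∈ stdSimplex ℝ (X i)) →
      outEnt V p (Finset.univ.erase k) - outEnt V p Finset.univ ≤
        outEnt V' p (Finset.univ.erase k) - outEnt V' p Finset.univ)
    {p : ∀ i, Fin (M i) → ℝ} (hp : ∀ i, p i ∈ stdSimplex ℝ (Fin (M i)))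
    (c : ∀ i, Fin (M i) → Fin n → X i) :
    outEnt (messageChannel V c) p (Finset.univ.erase k) -
        outEnt (messageChannel V c) p Finset.univ ≤
      outEnt (messageChannel V' c) p (Finset.univ.erase k) -
        outEnt (messageChannel V' c) p Finset.univ := by
  rw [outEnt_erase_sub hp, outEnt_erase_sub hp]
  refine Finset.sum_le_sum fun w _ => mul_le_mul_of_nonneg_left ?_ (prodLaw_nonneg hp w)
  have e : ∀ t a, (fun i => codewords c (Function.update w k a) i t) =
      Function.update (fun i => codewords c w i t) k (c k a t) := fun t a => by
    funext i
    by_cases hi : i = k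
    · subst hi; simp [codewords]
    · simp [codewords, hi]
  have := MoreCapable.pi (n := n)
    (K' := fun t a => V' (Function.update (fun i => codewords c w i t) k (c k a t)))
    (K := fun t a => V (Function.update (fun i => codewords c w i t) k (c k a t)))
    (fun t a => hV' _) (fun t a => hV _) fun t =>
      (moreCapable_of_outEnt_le hV hV' k h fun i => codewords c w i t).comp fun a => c k a t
  have := this (p k) (hp k).1
  unfold messageChannel blockChannel
  simpa only [e] using this

end Tensorization

/-! ### Converse bounds for a code -/

namespace DMIC

variable {X Y : Fin 3 → Type*} [∀ i, Fintype (X i)] [∀ i, Fintype (Y i)] (W : DMIC X Y)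

section Converse

theorem sum_decodingError_le {n : ℕ} {M : Fin 3 → ℕ} (C : InterferenceCode X Y M n) (k : Fin 3)
    [∀ (b : Fin n → Y k) (w : ∀ i, Fin (M i)), Decidable (C.dec k b ≠ w k)] :
    ∑ w : ∀ i, Fin (M i), prodLaw (fun i (_ : Fin (M i)) => (M i : ℝ)⁻¹) w *
      ∑ b, messageChannel (W.outputLaw k) C.enc w b * (if C.dec k b ≠ w k then 1 else 0) ≤
      W.errorProb C := by
  rw [errorProb, Finset.mul_sum]
  refine Finset.sum_le_sum fun w _ => ?_
  simp only [prodLaw, Finset.prod_inv_distrib]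
  refine mul_le_mul_of_nonneg_left ?_ (by positivity)
  rw [messageChannel, ← sum_prod_prob_mul]
  refine Finset.sum_le_sum fun y _ => ?_
  have hnn : 0 ≤ ∏ t, W.prob (fun i => C.enc i (w i) t) (y t) :=
    Finset.prod_nonneg fun t _ => (W.prob_mem _).1 _
  by_cases h : C.dec k (fun t => y t k) ≠ w k
  · rw [if_pos h, if_pos fun h' => h (congrFun h' k), mul_one]
    rfl
  · rw [if_neg h, mul_zero]
    split_ifs
    · exact hnn
    · exact le_rfl

/-- The conditional mutual information, in nats, of the inputs of the users outside `T` and the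
output of receiver `j` given the inputs of the users in `T`. -/
noncomputable def condInfo (p : ∀ i, X i → ℝ) (j : Fin 3) (T : Finset (Fin 3)) : ℝ :=
  outEnt (W.outputLaw j) p T - outEnt (W.outputLaw j) p Finset.univ

/-- Receiver `j'` sees user `k` at least as well as receiver `j` when the other inputs are known. -/
def Stronger (k j j' : Fin 3) : Prop :=
  ∀ p : ∀ i, X i → ℝ, (∀ i, p i ∈ stdSimplex ℝ (X i)) →
    W.condInfo p j (Finset.univ.erase k) ≤ W.condInfo p j' (Finset.univ.erase k)

variable {n : ℕ} {M : Fin 3 → ℕ}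

theorem uniform_mem_stdSimplex (hM : ∀ i, 0 < M i) (i : Fin 3) :
    (fun _ : Fin (M i) => (M i : ℝ)⁻¹) ∈ stdSimplex ℝ (Fin (M i)) := by
  have : (M i : ℝ) ≠ 0 := by exact_mod_cast (hM i).ne'
  exact ⟨fun _ => by positivity, by simp [this]⟩

/-- With `T = Finset.univ` all other messages are known to the receiver; a smaller `T` leaves some
unknown, as the chain rule for two users requires. -/
theorem log_card_le (hM : ∀ i, 0 < M i) (C : InterferenceCode X Y M n) {k : Fin 3}
    {T : Finset (Fin 3)} (hk : k ∈ T) :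
    (1 - W.errorProb C) * Real.log (M k) ≤
      outEnt (messageChannel (W.outputLaw k) C.enc) (fun i (_ : Fin (M i)) => (M i : ℝ)⁻¹)
        (T.erase k) -
      outEnt (messageChannel (W.outputLaw k) C.enc) (fun i (_ : Fin (M i)) => (M i : ℝ)⁻¹) T +
      Real.log 2 := by
  have h := log_card_le_outEnt_sub (uniform_mem_stdSimplex hM)
    (messageChannel_mem_stdSimplex (W.outputLaw_mem_stdSimplex k) C.enc) hk
    (fun a => by simp) (C.dec k)
  have hlog : 0 ≤ Real.log (M k) := Real.log_natCast_nonneg _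
  have := mul_le_mul_of_nonneg_right (W.sum_decodingError_le C k) hlog
  rw [Fintype.card_fin] at h
  linarith

theorem condInfo_message_le (hM : ∀ i, 0 < M i) (c : ∀ i, Fin (M i) → Fin n → X i) (j : Fin 3)
    (T : Finset (Fin 3)) :
    outEnt (messageChannel (W.outputLaw j) c) (fun i (_ : Fin (M i)) => (M i : ℝ)⁻¹) T -
      outEnt (messageChannel (W.outputLaw j) c) (fun i (_ : Fin (M i)) => (M i : ℝ)⁻¹) Finset.univ ≤
    ∑ t, W.condInfo (letterLaw (fun i (_ : Fin (M i)) => (M i : ℝ)⁻¹) c t) j T := by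
  simp only [condInfo, Finset.sum_sub_distrib]
  rw [← outEnt_messageChannel_univ (uniform_mem_stdSimplex hM) (W.outputLaw_mem_stdSimplex j)]
  exact sub_le_sub_right (outEnt_messageChannel_le (uniform_mem_stdSimplex hM)
    (W.outputLaw_mem_stdSimplex j) c T) _

theorem log_card_le_single (hM : ∀ i, 0 < M i) (C : InterferenceCode X Y M n) (k : Fin 3) :
    (1 - W.errorProb C) * Real.log (M k) ≤
      ∑ t, W.condInfo (letterLaw (fun i (_ : Fin (M i)) => (M i : ℝ)⁻¹) C.enc t) k
        (Finset.univ.erase k) + Real.log 2 := by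
  have h1 := W.log_card_le hM C (Finset.mem_univ k)
  have h2 := W.condInfo_message_le hM C.enc k (Finset.univ.erase k)
  linarith

/-- User `l` is bounded at receiver `l` given all other messages and moved to receiver `k` by `hs`;
user `k` is bounded at receiver `k` without knowledge of message `l`. The two entropy differences
telescope. -/
theorem log_card_add_le (hM : ∀ i, 0 < M i) (C : InterferenceCode X Y M n) {k l : Fin 3}
    (hkl : k ≠ l) (hs : W.Stronger l l k) :
    (1 - W.errorProb C) * (Real.log (M k) + Real.log (M l)) ≤
      ∑ t, W.condInfo (letterLaw (fun i (_ : Fin (M i)) => (M i : ℝ)⁻¹) C.enc t) k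
        ((Finset.univ.erase l).erase k) + 2 * Real.log 2 := by
  have h1 := W.log_card_le hM C (Finset.mem_univ l)
  have h2 := W.log_card_le hM C (Finset.mem_erase.2 ⟨hkl, Finset.mem_univ k⟩)
  have h3 := outEnt_messageChannel_sub_le (W.outputLaw_mem_stdSimplex l)
    (W.outputLaw_mem_stdSimplex k) l hs (uniform_mem_stdSimplex hM) C.enc
  have h4 := W.condInfo_message_le hM C.enc k ((Finset.univ.erase l).erase k)
  linarith

end Converse

/-! ### The region in nats: closedness, seven values, outer bound -/

section Region

/-- The six single-letter bounds of the rate region, in nats. -/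
noncomputable def boundVector (p : ∀ i, X i → ℝ) : Fin 6 → ℝ :=
  ![W.condInfo p 0 {1, 2}, W.condInfo p 1 {2, 0}, W.condInfo p 2 {0, 1},
    W.condInfo p 0 {2}, W.condInfo p 1 {2}, W.condInfo p 2 {1}]

/-- The rates `R` satisfy the bounds `v`, which are in nats. -/
def Satisfies (R : Fin 3 → ℝ) (v : Fin 6 → ℝ) : Prop :=
  R 0 * Real.log 2 ≤ v 0 ∧ R 1 * Real.log 2 ≤ v 1 ∧ R 2 * Real.log 2 ≤ v 2 ∧
    (R 0 + R 1) * Real.log 2 ≤ v 3 ∧ (R 0 + R 1) * Real.log 2 ≤ v 4 ∧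
    (R 2 + R 0) * Real.log 2 ≤ v 5

/-- The average of the bounds over the time-sharing variable. -/
noncomputable def averageBound {𝒬 : Type*} [Fintype 𝒬] (pQ : 𝒬 → ℝ)
    (pX : 𝒬 → ∀ i, stdSimplex ℝ (X i)) : Fin 6 → ℝ :=
  ∑ q, pQ q • W.boundVector fun i => (pX q i : X i → ℝ)

/-- All real triples that satisfy the rate bounds for some time-sharing variable. -/
def boundedRegion : Set (Fin 3 → ℝ) :=
  {R | ∃ (pQ : stdSimplex ℝ (Fin 7)) (pX : Fin 7 → ∀ i, stdSimplex ℝ (X i)),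
    Satisfies R (W.averageBound (pQ : Fin 7 → ℝ) pX)}

theorem condMutualInfo_eq_average (pQ : stdSimplex ℝ (Fin 7))
    (pX : Fin 7 → ∀ i, stdSimplex ℝ (X i)) :
    condMutualInfo (W.timeSharingLaw pQ pX)
      (fun ω => ω.2.1 0) (fun ω => ω.2.2 0) (fun ω => (ω.2.1 1, ω.2.1 2, ω.1)) * Real.log 2 =
      W.averageBound pQ pX 0 ∧
    condMutualInfo (W.timeSharingLaw pQ pX)
      (fun ω => ω.2.1 1) (fun ω => ω.2.2 1) (fun ω => (ω.2.1 2, ω.2.1 0, ω.1)) * Real.log 2 =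
      W.averageBound pQ pX 1 ∧
    condMutualInfo (W.timeSharingLaw pQ pX)
      (fun ω => ω.2.1 2) (fun ω => ω.2.2 2) (fun ω => (ω.2.1 0, ω.2.1 1, ω.1)) * Real.log 2 =
      W.averageBound pQ pX 2 ∧
    condMutualInfo (W.timeSharingLaw pQ pX) (fun ω => (ω.2.1 0, ω.2.1 1))
      (fun ω => ω.2.2 0) (fun ω => (ω.2.1 2, ω.1)) * Real.log 2 = W.averageBound pQ pX 3 ∧
    condMutualInfo (W.timeSharingLaw pQ pX) (fun ω => (ω.2.1 0, ω.2.1 1))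
      (fun ω => ω.2.2 1) (fun ω => (ω.2.1 2, ω.1)) * Real.log 2 = W.averageBound pQ pX 4 ∧
    condMutualInfo (W.timeSharingLaw pQ pX) (fun ω => (ω.2.1 2, ω.2.1 0))
      (fun ω => ω.2.2 2) (fun ω => (ω.2.1 1, ω.1)) * Real.log 2 = W.averageBound pQ pX 5 := by
  have e : ∀ k, W.averageBound pQ pX k =
      ∑ q, (pQ : Fin 7 → ℝ) q * W.boundVector (fun i => (pX q i : X i → ℝ)) k := fun k => by
    simp [averageBound]
  simp only [e]
  refine ⟨?_, ?_, ?_, ?_, ?_, ?_⟩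
  · exact W.condMutualInfo_timeSharingLaw pQ pX {1, 2} 0 (fun ω => ω.1 0) _
      (fun ω => (ω.1 1, ω.1 2)) (fun u v => by simp only [Prod.mk.injEq]; tauto)
      (fun u v => by simp) (fun u v => by simp [Fin.forall_fin_succ])
  · exact W.condMutualInfo_timeSharingLaw pQ pX {2, 0} 1 (fun ω => ω.1 1) _
      (fun ω => (ω.1 2, ω.1 0)) (fun u v => by simp only [Prod.mk.injEq]; tauto)
      (fun u v => by simp) (fun u v => by simp [Fin.forall_fin_succ]; tauto)
  · exact W.condMutualInfo_timeSharingLaw pQ pX {0, 1} 2 (fun ω => ω.1 2) _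
      (fun ω => (ω.1 0, ω.1 1)) (fun u v => by simp only [Prod.mk.injEq]; tauto)
      (fun u v => by simp) (fun u v => by simp [Fin.forall_fin_succ]; tauto)
  · exact W.condMutualInfo_timeSharingLaw pQ pX {2} 0 (fun ω => (ω.1 0, ω.1 1)) _
      (fun ω => ω.1 2) (fun u v => by simp only [Prod.mk.injEq]; tauto)
      (fun u v => by simp) (fun u v => by simp [Fin.forall_fin_succ]; tauto)
  · exact W.condMutualInfo_timeSharingLaw pQ pX {2} 1 (fun ω => (ω.1 0, ω.1 1)) _
      (fun ω => ω.1 2) (fun u v => by simp only [Prod.mk.injEq]; tauto)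
      (fun u v => by simp) (fun u v => by simp [Fin.forall_fin_succ]; tauto)
  · exact W.condMutualInfo_timeSharingLaw pQ pX {1} 2 (fun ω => (ω.1 2, ω.1 0)) _
      (fun ω => ω.1 1) (fun u v => by simp only [Prod.mk.injEq]; tauto)
      (fun u v => by simp) (fun u v => by simp [Fin.forall_fin_succ]; tauto)

theorem closedRegion_eq : W.closedRegion = W.boundedRegion ∩ {R | ∀ i, 0 ≤ R i} := by
  ext R
  rw [Set.inter_comm]
  refine and_congr_right fun _ => exists_congr fun pQ => exists_congr fun pX => ?_
  obtain ⟨h0, h1, h2, h3, h4, h5⟩ := W.condMutualInfo_eq_average pQ pX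
  rw [Satisfies, ← h0, ← h1, ← h2, ← h3, ← h4, ← h5, le_min_iff, and_assoc]
  simp only [mul_le_mul_iff_left₀ log_two_pos]

theorem strictRegion_subset : W.strictRegion ⊆ W.boundedRegion := by
  rintro R ⟨pQ, pX, h⟩
  refine ⟨pQ, pX, ?_⟩
  obtain ⟨h0, h1, h2, h3, h4, h5⟩ := W.condMutualInfo_eq_average pQ pX
  rw [Satisfies, ← h0, ← h1, ← h2, ← h3, ← h4, ← h5]
  simp only [mul_le_mul_iff_left₀ log_two_pos]
  obtain ⟨g0, g1, g2, g3, g4⟩ := h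
  rw [lt_min_iff] at g3
  exact ⟨g0.le, g1.le, g2.le, g3.1.le, g3.2.le, g4.le⟩

theorem sub_mem_strictRegion {R : Fin 3 → ℝ} (hR : R ∈ W.boundedRegion) {ε : ℝ} (hε : 0 < ε) :
    (fun i => R i - ε) ∈ W.strictRegion := by
  obtain ⟨pQ, pX, h⟩ := hR
  refine ⟨pQ, pX, ?_⟩
  obtain ⟨h0, h1, h2, h3, h4, h5⟩ := W.condMutualInfo_eq_average pQ pX
  rw [Satisfies, ← h0, ← h1, ← h2, ← h3, ← h4, ← h5] at h
  simp only [mul_le_mul_iff_left₀ log_two_pos] at h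
  obtain ⟨g0, g1, g2, g3, g4, g5⟩ := h
  rw [lt_min_iff]
  refine ⟨?_, ?_, ?_, ⟨?_, ?_⟩, ?_⟩ <;> linarith

theorem continuous_condInfo (j : Fin 3) (T : Finset (Fin 3)) :
    Continuous fun p : ∀ i, stdSimplex ℝ (X i) => W.condInfo (fun i => (p i : X i → ℝ)) j T := by
  have h1 : ∀ x : ∀ i, X i, Continuous fun p : ∀ i, stdSimplex ℝ (X i) =>
      prodLaw (fun i => (p i : X i → ℝ)) x := fun x =>
    continuous_finsetProd _ fun i _ => (continuous_apply (x i)).comp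
      (continuous_subtype_val.comp (continuous_apply i))
  have h2 : ∀ S, Continuous fun p : ∀ i, stdSimplex ℝ (X i) =>
      outEnt (W.outputLaw j) (fun i => (p i : X i → ℝ)) S := fun S =>
    continuous_finsetSum _ fun x _ => (h1 x).mul <| continuous_finsetSum _ fun b _ =>
      Real.continuous_negMulLog.comp <| continuous_finsetSum _ fun z _ =>
        (h1 z).mul continuous_const
  exact (h2 T).sub (h2 _)

/-- It is the projection of a closed set along the compact space of pairs `(pQ, pX)`. -/
theorem isClosed_boundedRegion : IsClosed W.boundedRegion := by
  let Z := stdSimplex ℝ (Fin 7) × (Fin 7 → ∀ i, stdSimplex ℝ (X i))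
  have hJ : Continuous fun p : ∀ i, stdSimplex ℝ (X i) =>
      W.boundVector fun i => (p i : X i → ℝ) := by
    refine continuous_pi fun k => ?_
    fin_cases k <;> exact W.continuous_condInfo _ _
  have hA : Continuous fun z : Z => W.averageBound (z.1 : Fin 7 → ℝ) z.2 := by
    have h1 : ∀ q, Continuous fun z : Z => (z.1 : Fin 7 → ℝ) q := fun q =>
      (continuous_apply q).comp (continuous_subtype_val.comp continuous_fst)
    have h2 : ∀ q, Continuous fun z : Z => W.boundVector fun i => (z.2 q i : X i → ℝ) := fun q =>
      hJ.comp ((continuous_apply q).comp continuous_snd)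
    exact continuous_finsetSum _ fun q _ => (h1 q).smul (h2 q)
  have hAk : ∀ k, Continuous fun u : Z × (Fin 3 → ℝ) =>
      W.averageBound (u.1.1 : Fin 7 → ℝ) u.1.2 k := fun k =>
    (continuous_apply k).comp (hA.comp continuous_fst)
  have hR : ∀ i, Continuous fun u : Z × (Fin 3 → ℝ) => u.2 i := fun i =>
    (continuous_apply i).comp continuous_snd
  have hcl : IsClosed {u : Z × (Fin 3 → ℝ) |
      Satisfies u.2 (W.averageBound (u.1.1 : Fin 7 → ℝ) u.1.2)} := by
    have h1 : ∀ i k, IsClosed {u : Z × (Fin 3 → ℝ) |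
        u.2 i * Real.log 2 ≤ W.averageBound (u.1.1 : Fin 7 → ℝ) u.1.2 k} := fun i k =>
      isClosed_le ((hR i).mul continuous_const) (hAk k)
    have h2 : ∀ i i' k, IsClosed {u : Z × (Fin 3 → ℝ) |
        (u.2 i + u.2 i') * Real.log 2 ≤ W.averageBound (u.1.1 : Fin 7 → ℝ) u.1.2 k} :=
      fun i i' k => isClosed_le (((hR i).add (hR i')).mul continuous_const) (hAk k)
    exact (h1 0 0).inter ((h1 1 1).inter ((h1 2 2).inter ((h2 0 1 3).inter
      ((h2 0 1 4).inter (h2 2 0 5)))))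
  have := (isClosedMap_snd_of_compactSpace (X := Z) (Y := Fin 3 → ℝ)) _ hcl
  convert this using 1
  ext R
  constructor
  · rintro ⟨pQ, pX, h⟩
    exact ⟨((pQ, pX), R), h, rfl⟩
  · rintro ⟨⟨⟨pQ, pX⟩, R'⟩, h, rfl⟩
    exact ⟨pQ, pX, h⟩

/-- Seven values of the time-sharing variable suffice. -/
theorem exists_averageBound_of_mem_convexHull {v : Fin 6 → ℝ}
    (hv : v ∈ convexHull ℝ (Set.range fun p : ∀ i, stdSimplex ℝ (X i) =>
      W.boundVector fun i => (p i : X i → ℝ))) :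
    ∃ (pQ : stdSimplex ℝ (Fin 7)) (pX : Fin 7 → ∀ i, stdSimplex ℝ (X i)),
      v = W.averageBound (pQ : Fin 7 → ℝ) pX := by
  obtain ⟨κ, hκ, z, w, hz, haff, hw, hw1, hsum⟩ := eq_pos_convex_span_of_mem_convexHull hv
  -- Carathéodory: affinely independent points of ℝ⁶ number at most seven.
  have hcard : Fintype.card κ ≤ Fintype.card (Fin 7) := by
    have h1 := haff.card_le_finrank_succ
    have h2 := Submodule.finrank_le (vectorSpan ℝ (Set.range z))
    rw [Module.finrank_fin_fun] at h2
    rw [Fintype.card_fin]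
    omega
  obtain ⟨f⟩ := Function.Embedding.nonempty_of_card_le hcard
  choose P hP using fun i => hz (Set.mem_range_self i)
  have hne : Nonempty κ := by
    by_contra h
    rw [not_nonempty_iff] at h
    simp at hw1
  -- Outside the range of `f` the weight `lawOf w f` is zero, so the filler is arbitrary.
  let pX : Fin 7 → ∀ i, stdSimplex ℝ (X i) := Function.extend f P fun _ => P (Classical.arbitrary κ)
  refine ⟨⟨lawOf w f, lawOf_mem_stdSimplex ⟨fun i => (hw i).le, hw1⟩ f⟩, pX, ?_⟩
  rw [← hsum]
  funext k
  have h := sum_lawOf_mul w f fun q => W.boundVector (fun i => (pX q i : X i → ℝ)) k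
  simp only [averageBound, Finset.sum_apply, Pi.smul_apply, smul_eq_mul]
  refine Eq.trans ?_ h.symm
  refine Finset.sum_congr rfl fun i _ => ?_
  rw [← hP i]
  simp only [pX, f.injective.extend_apply]

theorem mem_boundedRegion_of_achievable (h0 : W.Stronger 1 1 0) (h1 : W.Stronger 0 0 1)
    (h2 : W.Stronger 0 0 2) {R : Fin 3 → ℝ} (hR : W.Achievable R) : R ∈ W.boundedRegion := by
  obtain ⟨-, C, hC⟩ := hR
  have hinv : Tendsto (fun n : ℕ => 4 * (n : ℝ)⁻¹) atTop (𝓝 (4 * 0)) :=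
    tendsto_inv_atTop_nhds_zero_nat.const_mul 4
  -- The shift 4/n absorbs the Fano terms, at most `log 2` for each rate. Shifted rates may be
  -- negative, which `boundedRegion` permits; closedness then gives `R` itself.
  have hlim : Tendsto (fun n i => (1 - W.errorProb (C n)) * R i - 4 * (n : ℝ)⁻¹) atTop (𝓝 R) := by
    rw [tendsto_pi_nhds]
    intro i
    simpa using ((hC.const_sub 1).mul_const (R i)).sub hinv
  refine W.isClosed_boundedRegion.mem_of_tendsto hlim ?_
  filter_upwards [hC.eventually (gt_mem_nhds one_pos), eventually_gt_atTop 0] with n hPe hn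
  set Pe := W.errorProb (C n)
  let M : Fin 3 → ℕ := fun i => ⌈(2 : ℝ) ^ ((n : ℝ) * R i)⌉₊
  have hM : ∀ i, 0 < M i := fun i => Nat.ceil_pos.2 (by positivity)
  have hn' : (0 : ℝ) < n := by exact_mod_cast hn
  let p : Fin n → ∀ i, stdSimplex ℝ (X i) := fun t i =>
    ⟨letterLaw (fun i (_ : Fin (M i)) => (M i : ℝ)⁻¹) (C n).enc t i,
      letterLaw_mem_stdSimplex (uniform_mem_stdSimplex hM) _ t i⟩
  have hlogM : ∀ i, n * (R i * Real.log 2) ≤ Real.log (M i) := fun i => by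
    have := Real.log_le_log (by positivity) (Nat.le_ceil ((2 : ℝ) ^ ((n : ℝ) * R i)))
    rwa [Real.log_rpow two_pos, mul_assoc] at this
  -- The time index, uniform on the block, acts as the time-sharing variable.
  have hv : (∑ t, (n : ℝ)⁻¹ • W.boundVector fun i => (p t i : X i → ℝ)) ∈
      convexHull ℝ (Set.range fun p : ∀ i, stdSimplex ℝ (X i) =>
        W.boundVector fun i => (p i : X i → ℝ)) :=
    (convex_convexHull ℝ _).sum_mem (fun t _ => by positivity) (by simp [hn'.ne'])
      fun t _ => subset_convexHull ℝ _ ⟨p t, rfl⟩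
  obtain ⟨pQ, pX, hvQ⟩ := W.exists_averageBound_of_mem_convexHull hv
  refine ⟨pQ, pX, ?_⟩
  rw [← hvQ]
  have hc : ∀ k, (∑ t, (n : ℝ)⁻¹ • W.boundVector fun i => (p t i : X i → ℝ)) k =
      (n : ℝ)⁻¹ * ∑ t, W.boundVector (letterLaw (fun i (_ : Fin (M i)) => (M i : ℝ)⁻¹)
        (C n).enc t) k := fun k => by
    rw [Finset.sum_apply, Finset.mul_sum]; rfl
  have hPe' : 0 ≤ 1 - Pe := by linarith
  have hl2 := log_two_pos
  have single : ∀ (k : Fin 3) (S : ℝ), (1 - Pe) * Real.log (M k) ≤ S + Real.log 2 →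
      ((1 - Pe) * R k - 4 * (n : ℝ)⁻¹) * Real.log 2 ≤ (n : ℝ)⁻¹ * S := fun k S h => by
    have := mul_le_mul_of_nonneg_left (hlogM k) hPe'
    have h3 : (n : ℝ) * (((1 - Pe) * R k - 4 * (n : ℝ)⁻¹) * Real.log 2) ≤ S := by
      have : (n : ℝ) * (((1 - Pe) * R k - 4 * (n : ℝ)⁻¹) * Real.log 2) =
        (1 - Pe) * (n * (R k * Real.log 2)) - 4 * Real.log 2 := by field_simp
      linarith
    rwa [← div_eq_inv_mul, le_div_iff₀' hn']
  have double : ∀ (k l : Fin 3) (S : ℝ),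
      (1 - Pe) * (Real.log (M k) + Real.log (M l)) ≤ S + 2 * Real.log 2 →
      ((1 - Pe) * R k - 4 * (n : ℝ)⁻¹ + ((1 - Pe) * R l - 4 * (n : ℝ)⁻¹)) * Real.log 2 ≤
        (n : ℝ)⁻¹ * S := fun k l S h => by
    have a1 := mul_le_mul_of_nonneg_left (hlogM k) hPe'
    have a2 := mul_le_mul_of_nonneg_left (hlogM l) hPe'
    have h3 : (n : ℝ) * (((1 - Pe) * R k - 4 * (n : ℝ)⁻¹ +
        ((1 - Pe) * R l - 4 * (n : ℝ)⁻¹)) * Real.log 2) ≤ S := by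
      have : (n : ℝ) * (((1 - Pe) * R k - 4 * (n : ℝ)⁻¹ +
          ((1 - Pe) * R l - 4 * (n : ℝ)⁻¹)) * Real.log 2) =
        (1 - Pe) * (n * (R k * Real.log 2)) + (1 - Pe) * (n * (R l * Real.log 2)) -
          8 * Real.log 2 := by field_simp; ring
      linarith
    rwa [← div_eq_inv_mul, le_div_iff₀' hn']
  simp only [Satisfies, hc]
  have e0 : Finset.univ.erase (0 : Fin 3) = {1, 2} := by decide
  have e1 : Finset.univ.erase (1 : Fin 3) = {2, 0} := by decide
  have e2 : Finset.univ.erase (2 : Fin 3) = {0, 1} := by decide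
  have e3 : (Finset.univ.erase (1 : Fin 3)).erase 0 = {2} := by decide
  have e4 : (Finset.univ.erase (0 : Fin 3)).erase 1 = {2} := by decide
  have e5 : (Finset.univ.erase (0 : Fin 3)).erase 2 = {1} := by decide
  refine ⟨single 0 _ ?_, single 1 _ ?_, single 2 _ ?_, double 0 1 _ ?_, ?_, double 2 0 _ ?_⟩
  · have h := W.log_card_le_single hM (C n) 0
    rw [e0] at h
    exact h
  · have h := W.log_card_le_single hM (C n) 1
    rw [e1] at h
    exact h
  · have h := W.log_card_le_single hM (C n) 2
    rw [e2] at h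
    exact h
  · have h := W.log_card_add_le hM (C n) (by decide : (0 : Fin 3) ≠ 1) h0
    rw [e3] at h
    exact h
  -- Here receiver `1` takes the place of receiver `0`, so the two users enter in the opposite
  -- order.
  · rw [add_comm ((1 - Pe) * R 0 - 4 * (n : ℝ)⁻¹)]
    refine double 1 0 _ ?_
    have h := W.log_card_add_le hM (C n) (by decide : (1 : Fin 3) ≠ 0) h1
    rw [e4] at h
    exact h
  · have h := W.log_card_add_le hM (C n) (by decide : (2 : Fin 3) ≠ 0) h2
    rw [e5] at h
    exact h

end Region

end DMIC

/-! ### Strong and very strong interference; the capacity region -/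

namespace DMIC

variable {X Y : Fin 3 → Type*} [∀ i, Fintype (X i)] [∀ i, Fintype (Y i)] (W : DMIC X Y)

/-- Receiver `j'` decodes user `k`, treating the other users as noise, at any rate at which receiver
`j` decodes user `k` when it knows the other inputs. -/
def VeryStrong (k j j' : Fin 3) : Prop :=
  ∀ p : ∀ i, X i → ℝ, (∀ i, p i ∈ stdSimplex ℝ (X i)) →
    W.condInfo p j (Finset.univ.erase k) ≤
      outEnt (W.outputLaw j') p ∅ - outEnt (W.outputLaw j') p {k}

/-- For all three users, receivers `0` and `1` add R₃ ≤ I[X₃; Y_j] to the bound on R₁ + R₂, and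
receiver `2` adds R₂ ≤ I[X₂; Y₃] to the bound on R₃ + R₁. Smaller sets follow from the single or sum
bounds, the strong conditions, and the fact that conditioning on further inputs increases the
information about a very strong interferer. -/
theorem sum_mul_le_of_mem_boundedRegion (h32 : W.VeryStrong 2 2 1) (h23 : W.VeryStrong 1 1 2)
    (h31 : W.VeryStrong 2 2 0) (h13 : W.Stronger 0 0 2) (h21 : W.Stronger 1 1 0)
    (h12 : W.Stronger 0 0 1) {pQ : stdSimplex ℝ (Fin 7)} {pX : Fin 7 → ∀ i, stdSimplex ℝ (X i)}
    {R : Fin 3 → ℝ} (hR : Satisfies R (W.averageBound (pQ : Fin 7 → ℝ) pX)) (j : Fin 3)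
    {S : Finset (Fin 3)} (hS : S.Nonempty) :
    (∑ i ∈ S, R i) * Real.log 2 ≤ ∑ q, (pQ : Fin 7 → ℝ) q *
      (outEnt (W.outputLaw j) (fun i => (pX q i : X i → ℝ)) Sᶜ -
        outEnt (W.outputLaw j) (fun i => (pX q i : X i → ℝ)) Finset.univ) := by
  have hp : ∀ q i, (pX q i : X i → ℝ) ∈ stdSimplex ℝ (X i) := fun q i => (pX q i).2
  -- The averaged entropies are made opaque atoms, so that what remains is linear arithmetic.
  obtain ⟨A, hA⟩ : ∃ A : Fin 3 → Finset (Fin 3) → ℝ, ∀ j T, A j T = ∑ q, (pQ : Fin 7 → ℝ) q *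
    outEnt (W.outputLaw j) (fun i => (pX q i : X i → ℝ)) T := ⟨_, fun _ _ => rfl⟩
  have hsub : ∀ j T T', ∑ q, (pQ : Fin 7 → ℝ) q *
      (outEnt (W.outputLaw j) (fun i => (pX q i : X i → ℝ)) T -
        outEnt (W.outputLaw j) (fun i => (pX q i : X i → ℝ)) T') = A j T - A j T' :=
    fun j T T' => by simp only [hA, mul_sub, Finset.sum_sub_distrib]
  have hle : ∀ j T T' j' U U', (∀ q, outEnt (W.outputLaw j) (fun i => (pX q i : X i → ℝ)) T -
        outEnt (W.outputLaw j) (fun i => (pX q i : X i → ℝ)) T' ≤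
        outEnt (W.outputLaw j') (fun i => (pX q i : X i → ℝ)) U -
        outEnt (W.outputLaw j') (fun i => (pX q i : X i → ℝ)) U') →
      A j T - A j T' ≤ A j' U - A j' U' := fun j T T' j' U U' h => by
    rw [← hsub, ← hsub]
    exact Finset.sum_le_sum fun q _ => mul_le_mul_of_nonneg_left (h q) (pQ.2.1 q)
  have e0 : Finset.univ.erase (0 : Fin 3) = {1, 2} := by decide
  have e1 : Finset.univ.erase (1 : Fin 3) = {0, 2} := by decide
  have e2 : Finset.univ.erase (2 : Fin 3) = {0, 1} := by decide
  have b32 := hle _ _ _ _ _ _ fun q => h32 _ (hp q)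
  have b23 := hle _ _ _ _ _ _ fun q => h23 _ (hp q)
  have b31 := hle _ _ _ _ _ _ fun q => h31 _ (hp q)
  have b13 := hle _ _ _ _ _ _ fun q => h13 _ (hp q)
  have b21 := hle _ _ _ _ _ _ fun q => h21 _ (hp q)
  have b12 := hle _ _ _ _ _ _ fun q => h12 _ (hp q)
  have hsm : ∀ j (S T : Finset (Fin 3)), Disjoint S T → A j (S ∪ T) + A j ∅ ≤ A j S + A j T :=
    fun j S T hST => by
      have := hle j (S ∪ T) S j T ∅ fun q => by
        have := outEnt_submodular (hp q) (W.outputLaw_mem_stdSimplex j) hST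
        linarith
      linarith
  have hb : ∀ k, W.averageBound (pQ : Fin 7 → ℝ) pX k =
      ∑ q, (pQ : Fin 7 → ℝ) q * W.boundVector (fun i => (pX q i : X i → ℝ)) k := fun k => by
    simp [averageBound]
  have hb0 : W.averageBound (pQ : Fin 7 → ℝ) pX 0 = A 0 {1, 2} - A 0 Finset.univ :=
    (hb 0).trans (hsub 0 {1, 2} Finset.univ)
  have hb1 : W.averageBound (pQ : Fin 7 → ℝ) pX 1 = A 1 {0, 2} - A 1 Finset.univ :=
    ((hb 1).trans (hsub 1 {2, 0} Finset.univ)).trans (by rw [Finset.pair_comm])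
  have hb2 : W.averageBound (pQ : Fin 7 → ℝ) pX 2 = A 2 {0, 1} - A 2 Finset.univ :=
    (hb 2).trans (hsub 2 {0, 1} Finset.univ)
  have hb3 : W.averageBound (pQ : Fin 7 → ℝ) pX 3 = A 0 {2} - A 0 Finset.univ :=
    (hb 3).trans (hsub 0 {2} Finset.univ)
  have hb4 : W.averageBound (pQ : Fin 7 → ℝ) pX 4 = A 1 {2} - A 1 Finset.univ :=
    (hb 4).trans (hsub 1 {2} Finset.univ)
  have hb5 : W.averageBound (pQ : Fin 7 → ℝ) pX 5 = A 2 {1} - A 2 Finset.univ :=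
    (hb 5).trans (hsub 2 {1} Finset.univ)
  obtain ⟨r0, r1, r2, r3, r4, r5⟩ := hR
  rw [hb0] at r0
  rw [hb1] at r1
  rw [hb2] at r2
  rw [hb3] at r3
  rw [hb4] at r4
  rw [hb5] at r5
  rw [e0] at b13 b12
  rw [e1] at b21 b23
  rw [e2] at b32 b31
  have s1 := fun j => hsm j {0} {1} (by decide)
  have s2 := fun j => hsm j {0} {2} (by decide)
  have s3 := fun j => hsm j {1} {2} (by decide)
  have s4 := fun j => hsm j {0, 1} {2} (by decide)
  have s5 := fun j => hsm j {0, 2} {1} (by decide)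
  rw [show ({0} ∪ {1} : Finset (Fin 3)) = {0, 1} by decide] at s1
  rw [show ({0} ∪ {2} : Finset (Fin 3)) = {0, 2} by decide] at s2
  rw [show ({1} ∪ {2} : Finset (Fin 3)) = {1, 2} by decide] at s3
  rw [show ({0, 1} ∪ {2} : Finset (Fin 3)) = Finset.univ by decide] at s4
  rw [show ({0, 2} ∪ {1} : Finset (Fin 3)) = Finset.univ by decide] at s5
  rw [hsub]
  have hcases : ∀ S : Finset (Fin 3), S.Nonempty → S = {0} ∨ S = {1} ∨ S = {2} ∨ S = {0, 1} ∨
      S = {0, 2} ∨ S = {1, 2} ∨ S = Finset.univ := by decide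
  have c0 : ({0} : Finset (Fin 3))ᶜ = {1, 2} := by decide
  have c1 : ({1} : Finset (Fin 3))ᶜ = {0, 2} := by decide
  have c2 : ({2} : Finset (Fin 3))ᶜ = {0, 1} := by decide
  have c3 : ({0, 1} : Finset (Fin 3))ᶜ = {2} := by decide
  have c4 : ({0, 2} : Finset (Fin 3))ᶜ = {1} := by decide
  have c5 : ({1, 2} : Finset (Fin 3))ᶜ = {0} := by decide
  have i0 := s1 j
  have i1 := s2 j
  have i2 := s3 j
  have i3 := s4 j
  have i4 := s5 j
  have p3 : ∑ i ∈ ({0, 1} : Finset (Fin 3)), R i = R 0 + R 1 := Finset.sum_pair (by decide)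
  have p4 : ∑ i ∈ ({0, 2} : Finset (Fin 3)), R i = R 0 + R 2 := Finset.sum_pair (by decide)
  have p5 : ∑ i ∈ ({1, 2} : Finset (Fin 3)), R i = R 1 + R 2 := Finset.sum_pair (by decide)
  rcases hcases S hS with rfl | rfl | rfl | rfl | rfl | rfl | rfl
  · rw [c0, Finset.sum_singleton]
    fin_cases j <;> simp only [Fin.zero_eta, Fin.mk_one, Fin.reduceFinMk] at * <;> linarith
  · rw [c1, Finset.sum_singleton]
    fin_cases j <;> simp only [Fin.zero_eta, Fin.mk_one, Fin.reduceFinMk] at * <;> linarith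
  · rw [c2, Finset.sum_singleton]
    fin_cases j <;> simp only [Fin.zero_eta, Fin.mk_one, Fin.reduceFinMk] at * <;> linarith
  · rw [c3, p3]
    fin_cases j <;> simp only [Fin.zero_eta, Fin.mk_one, Fin.reduceFinMk] at * <;> linarith
  · rw [c4, p4]
    fin_cases j <;> simp only [Fin.zero_eta, Fin.mk_one, Fin.reduceFinMk] at * <;> linarith
  · rw [c5, p5]
    fin_cases j <;> simp only [Fin.zero_eta, Fin.mk_one, Fin.reduceFinMk] at * <;> linarith
  · rw [Finset.compl_univ, Fin.sum_univ_three]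
    fin_cases j <;> simp only [Fin.zero_eta, Fin.mk_one, Fin.reduceFinMk] at * <;> linarith

/-- Scaling makes each inequality strict when all rates in `S` are positive; a zero rate in `S` is
the other alternative of `achievable_of_lt`. -/
theorem achievable_smul (h32 : W.VeryStrong 2 2 1) (h23 : W.VeryStrong 1 1 2)
    (h31 : W.VeryStrong 2 2 0) (h13 : W.Stronger 0 0 2) (h21 : W.Stronger 1 1 0)
    (h12 : W.Stronger 0 0 1) {R : Fin 3 → ℝ} (hR : R ∈ W.boundedRegion) (hR0 : ∀ i, 0 ≤ R i)
    {r : ℝ} (hr0 : 0 ≤ r) (hr1 : r < 1) : W.Achievable (r • R) := by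
  obtain ⟨pQ, pX, h⟩ := hR
  refine W.achievable_of_lt pQ pX (fun i => mul_nonneg hr0 (hR0 i)) fun j S hS => ?_
  by_cases h0 : ∃ i ∈ S, R i = 0
  · obtain ⟨i, hi, h0⟩ := h0
    exact Or.inl ⟨i, hi, by simp [h0]⟩
  · right
    push Not at h0
    refine lt_of_lt_of_le ?_ (W.sum_mul_le_of_mem_boundedRegion h32 h23 h31 h13 h21 h12 h j hS)
    have hpos : 0 < ∑ i ∈ S, R i :=
      Finset.sum_pos (fun i hi => lt_of_le_of_ne (hR0 i) (h0 i hi).symm) hS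
    simp only [Pi.smul_apply, smul_eq_mul, ← Finset.mul_sum]
    exact mul_lt_mul_of_pos_right (mul_lt_of_lt_one_left hpos hr1) log_two_pos

theorem capacityRegion_eq (h32 : W.VeryStrong 2 2 1) (h23 : W.VeryStrong 1 1 2)
    (h31 : W.VeryStrong 2 2 0) (h13 : W.Stronger 0 0 2) (h21 : W.Stronger 1 1 0)
    (h12 : W.Stronger 0 0 1) :
    W.capacityRegion = W.boundedRegion ∩ {R | ∀ i, 0 ≤ R i} := by
  have hnn : IsClosed {R : Fin 3 → ℝ | ∀ i, 0 ≤ R i} := by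
    simp only [Set.ofPred_forall]
    exact isClosed_iInter fun i => isClosed_le continuous_const (continuous_apply i)
  refine Set.Subset.antisymm ?_ ?_
  · exact closure_minimal
      (fun R hR => ⟨W.mem_boundedRegion_of_achievable h21 h12 h13 hR, hR.1⟩)
      (W.isClosed_boundedRegion.inter hnn)
  · rintro R ⟨hR, hR0⟩
    have hlim : Tendsto (fun n : ℕ => (1 - 1 / ((n : ℝ) + 1)) • R) atTop (𝓝 R) := by
      simpa using ((tendsto_one_div_add_atTop_nhds_zero_nat (𝕜 := ℝ)).const_sub 1).smul_const R
    refine mem_closure_of_tendsto hlim (Eventually.of_forall fun n => ?_)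
    have h1 : 0 < 1 / ((n : ℝ) + 1) := by positivity
    have h2 : 1 / ((n : ℝ) + 1) ≤ 1 := by
      rw [div_le_one (by positivity)]
      linarith [(Nat.cast_nonneg n : (0 : ℝ) ≤ n)]
    exact W.achievable_smul h32 h23 h31 h13 h21 h12 hR hR0 (by linarith) (by linarith)

/-- Lowering every rate by `ε` makes all bounds strict but may leave the nonnegative orthant; hence
nonnegativity is imposed only after the closure. -/
theorem closure_strictRegion : closure W.strictRegion = W.boundedRegion := by
  refine Set.Subset.antisymm (closure_minimal W.strictRegion_subset W.isClosed_boundedRegion) ?_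
  intro R hR
  have hlim : Tendsto (fun (n : ℕ) i => R i - 1 / ((n : ℝ) + 1)) atTop (𝓝 R) := by
    rw [tendsto_pi_nhds]
    intro i
    simpa using (tendsto_one_div_add_atTop_nhds_zero_nat (𝕜 := ℝ)).const_sub (R i)
  exact mem_closure_of_tendsto hlim
    (Eventually.of_forall fun n => W.sub_mem_strictRegion hR (by positivity))

theorem and_forall_mem_erase_iff {ι : Type*} [Fintype ι] [DecidableEq ι] {k : ι} (P : ι → Prop) :
    (P k ∧ ∀ i ∈ Finset.univ.erase k, P i) ↔ ∀ i, P i := by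
  refine ⟨fun hk i => ?_, fun h => ⟨h k, fun i _ => h i⟩⟩
  by_cases hi : i = k
  · exact hi ▸ hk.1
  · exact hk.2 i (by simp [hi])

theorem stronger_of_condMutualInfo {γ : Type*} [Fintype γ] {k j j' : Fin 3}
    (C : (∀ i, X i) × (∀ i, Y i) → γ)
    (hC : ∀ u v, C u = C v ↔ ∀ i ∈ Finset.univ.erase k, u.1 i = v.1 i)
    (h : ∀ p : ∀ i, stdSimplex ℝ (X i),
      condMutualInfo (W.jointLaw p) (fun ω => ω.1 k) (fun ω => ω.2 j) C ≤
        condMutualInfo (W.jointLaw p) (fun ω => ω.1 k) (fun ω => ω.2 j') C) :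
    W.Stronger k j j' := by
  have hAC : ∀ u v : (∀ i, X i) × (∀ i, Y i), u.1 k = v.1 k ∧ C u = C v ↔ ∀ i, u.1 i = v.1 i :=
    fun u v => by rw [hC, and_forall_mem_erase_iff fun i => u.1 i = v.1 i]
  intro p hp
  have := mul_le_mul_of_nonneg_right (h fun i => ⟨p i, hp i⟩) log_two_pos.le
  rwa [W.condMutualInfo_jointLaw _ _ j _ C hC hAC, W.condMutualInfo_jointLaw _ _ j' _ C hC hAC]
    at this

theorem veryStrong_of_condMutualInfo {γ : Type*} [Fintype γ] {k j j' : Fin 3}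
    (C : (∀ i, X i) × (∀ i, Y i) → γ)
    (hC : ∀ u v, C u = C v ↔ ∀ i ∈ Finset.univ.erase k, u.1 i = v.1 i)
    (h : ∀ p : ∀ i, stdSimplex ℝ (X i),
      mutualInfo (W.jointLaw p) (fun ω => ω.1 k) (fun ω => ω.2 j') ≥
        condMutualInfo (W.jointLaw p) (fun ω => ω.1 k) (fun ω => ω.2 j) C) :
    W.VeryStrong k j j' := by
  have hAC : ∀ u v : (∀ i, X i) × (∀ i, Y i), u.1 k = v.1 k ∧ C u = C v ↔ ∀ i, u.1 i = v.1 i :=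
    fun u v => by rw [hC, and_forall_mem_erase_iff fun i => u.1 i = v.1 i]
  intro p hp
  have := mul_le_mul_of_nonneg_right (h fun i => ⟨p i, hp i⟩) log_two_pos.le
  rwa [W.condMutualInfo_jointLaw _ _ j _ C hC hAC, W.mutualInfo_jointLaw] at this

end DMIC

theorem theorem2 {X Y : Fin 3 → Type*} [∀ i, Fintype (X i)] [∀ i, Fintype (Y i)]
    (W : DMIC X Y)
    -- I[X₃;Y₂] ≥ I[X₃;Y₃|X₁,X₂]
    (very_strong_3_at_2 : ∀ p : ∀ i, stdSimplex ℝ (X i),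
      mutualInfo (W.jointLaw p) (fun ω => ω.1 2) (fun ω => ω.2 1) ≥
        condMutualInfo (W.jointLaw p) (fun ω => ω.1 2) (fun ω => ω.2 2)
          (fun ω => (ω.1 0, ω.1 1)))
    -- I[X₂;Y₃] ≥ I[X₂;Y₂|X₃,X₁]
    (very_strong_2_at_3 : ∀ p : ∀ i, stdSimplex ℝ (X i),
      mutualInfo (W.jointLaw p) (fun ω => ω.1 1) (fun ω => ω.2 2) ≥
        condMutualInfo (W.jointLaw p) (fun ω => ω.1 1) (fun ω => ω.2 1)
          (fun ω => (ω.1 2, ω.1 0)))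
    -- I[X₃;Y₁] ≥ I[X₃;Y₃|X₁,X₂]
    (very_strong_3_at_1 : ∀ p : ∀ i, stdSimplex ℝ (X i),
      mutualInfo (W.jointLaw p) (fun ω => ω.1 2) (fun ω => ω.2 0) ≥
        condMutualInfo (W.jointLaw p) (fun ω => ω.1 2) (fun ω => ω.2 2)
          (fun ω => (ω.1 0, ω.1 1)))
    -- I[X₁;Y₁|X₂,X₃] ≤ I[X₁;Y₃|X₂,X₃]
    (strong_1_at_3 : ∀ p : ∀ i, stdSimplex ℝ (X i),
      condMutualInfo (W.jointLaw p) (fun ω => ω.1 0) (fun ω => ω.2 0)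
          (fun ω => (ω.1 1, ω.1 2)) ≤
        condMutualInfo (W.jointLaw p) (fun ω => ω.1 0) (fun ω => ω.2 2)
          (fun ω => (ω.1 1, ω.1 2)))
    -- I[X₂;Y₂|X₃,X₁] ≤ I[X₂;Y₁|X₃,X₁]
    (strong_2_at_1 : ∀ p : ∀ i, stdSimplex ℝ (X i),
      condMutualInfo (W.jointLaw p) (fun ω => ω.1 1) (fun ω => ω.2 1)
          (fun ω => (ω.1 2, ω.1 0)) ≤
        condMutualInfo (W.jointLaw p) (fun ω => ω.1 1) (fun ω => ω.2 0)
          (fun ω => (ω.1 2, ω.1 0)))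
    -- I[X₁;Y₁|X₂,X₃] ≤ I[X₁;Y₂|X₂,X₃]
    (strong_1_at_2 : ∀ p : ∀ i, stdSimplex ℝ (X i),
      condMutualInfo (W.jointLaw p) (fun ω => ω.1 0) (fun ω => ω.2 0)
          (fun ω => (ω.1 1, ω.1 2)) ≤
        condMutualInfo (W.jointLaw p) (fun ω => ω.1 0) (fun ω => ω.2 1)
          (fun ω => (ω.1 1, ω.1 2))) :
    W.capacityRegion = W.closedRegion ∧
      W.capacityRegion = closure W.strictRegion ∩ {R | ∀ i, 0 ≤ R i} := by
  have h32 := W.veryStrong_of_condMutualInfo (k := 2) _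
    (fun u v => by simp [Fin.forall_fin_succ]) very_strong_3_at_2
  have h23 := W.veryStrong_of_condMutualInfo (k := 1) _
    (fun u v => by simp [Fin.forall_fin_succ, and_comm]) very_strong_2_at_3
  have h31 := W.veryStrong_of_condMutualInfo (k := 2) _
    (fun u v => by simp [Fin.forall_fin_succ]) very_strong_3_at_1
  have h13 := W.stronger_of_condMutualInfo (k := 0) _
    (fun u v => by simp [Fin.forall_fin_succ]) strong_1_at_3
  have h21 := W.stronger_of_condMutualInfo (k := 1) _
    (fun u v => by simp [Fin.forall_fin_succ, and_comm]) strong_2_at_1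
  have h12 := W.stronger_of_condMutualInfo (k := 0) _
    (fun u v => by simp [Fin.forall_fin_succ]) strong_1_at_2
  rw [W.capacityRegion_eq h32 h23 h31 h13 h21 h12, W.closedRegion_eq, W.closure_strictRegion]
  exact ⟨rfl, rfl⟩
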